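/- Let $k$ and $l$ be $\mathbb Z$-graded commutative rings (commutativity up to the sign $(-1)^{|a||b|}$). Let $\mathrm{Alg}_k$ be the category of graded commutative $k$-algebras and $\mathrm{Mod}_l$ the category of graded right $l$-modules with degree-preserving $l$-linear maps. A formal scheme over $k$ is a functor from $\mathrm{Alg}_k$ to graded sets which in every degree is a small filtered colimit of representable functors; a formal $l$-module scheme over $k$ is a functor $F\colon \mathrm{Alg}_k\to\mathrm{Mod}_l$ whose underlying functor to graded sets is a formal scheme. Let $\mathrm{Sch}_k$ and $\mathrm{fModSch}_k^l$ denote the categories of these, with all natural transformations as morphisms, and let $V\colon \mathrm{fModSch}_k^l\to \mathrm{Sch}_k$ be the forgetful functor. For functors $F,G$ to graded sets, $F\times G$ is the functor $R\mapsto\bigl(\coprod_{p+q=n}F(R)_p\times G(R)_q\bigr)_{n}$. A natural transformation $\varphi\colon F\times G\to H$, with $F,G,H$ functors to graded $l$-modules, is $l$-bilinear if it is additive in each variable, $\varphi(x,ya)=\varphi(x,y)a$ and $\varphi(xa,y)=(-1)^{|a||y|}\varphi(x,y)a$. Then the tensor product of formal $l$-module schemes over $k$ exists: there are a functor $\otimes_l\colon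 \mathrm{fModSch}_k^l\times \mathrm{fModSch}_k^l\to \mathrm{fModSch}_k^l$ and $l$-bilinear natural transformations $\upsilon_{F,G}\colon F\times G\to F\otimes_l G$, natural in $F$ and $G$, such that for all $F,G,H\in \mathrm{fModSch}_k^l$: 1. $\upsilon_{F,G}$ extends to a natural transformation $F(-)\otimes_l G(-)\to F\otimes_l G$ on the objectwise tensor product of graded $l$-modules, and composition with it is a bijection from the morphisms $F\otimes_l G\to H$ of formal module schemes to the natural transformations $F(-)\otimes_l G(-)\to H$ of functors $\mathrm{Alg}_k\to\mathrm{Mod}_l$; 2. every $l$-bilinear natural transformation $F\times G\to H$ factors uniquely through $\upsilon_{F,G}$ by a morphism $F\otimes_l G\to H$ of formal module schemes. Moreover, $F\otimes_l G$ is a coequalizer of free formal module schemes: $V$ has a left adjoint $\mathrm{Fr}_l$; for all $F,G\in \mathrm{fModSch}_k^l$ there are a formal scheme $P$ with a natural transformation $\pi\colon F\times G\to P$ through which every natural transformation from $F\times G$ to a formal scheme factors uniquely (the product of $F$ and $G$ as graded formal schemes), a formal scheme $X$, and a coequalizer diagram $$\mathrm{Fr}_l(X)\rightrightarrows \mathrm{Fr}_l(P)\xrightarrow{\;q\;}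 F\otimes_l G$$ in $\mathrm{fModSch}_k^l$ such that the composite of $\pi$ with the adjoint $P\to V(F\otimes_l G)$ of $q$ is $\upsilon_{F,G}$. -/

import Mathlib

open CategoryTheory CategoryTheory.Limits

universe u

/-- A `ℤ`-graded commutative ring: a family of abelian groups `X i` with a unit in degree `0` and an
associative multiplication `X i × X j → X (i + j)` which is commutative up to the sign
`(-1) ^ (i * j)`. The degree of a product is recorded by an equation `i + j = n`, so that no
casts are needed. -/
structure GrCommRing : Type (u + 1) where
  X : ℤ → Type u
  [grp : ∀ i, AddCommGroup (X i)]
  one : X 0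
  mul : ∀ {i j n : ℤ}, i + j = n → X i →+ X j →+ X n
  one_mul : ∀ {i : ℤ} (a : X i), mul (zero_add i) one a = a
  mul_assoc : ∀ {i j m p q n : ℤ} (h₁ : i + j = p) (h₂ : p + m = n) (h₃ : j + m = q)
    (h₄ : i + q = n) (a : X i) (b : X j) (c : X m),
    mul h₂ (mul h₁ a b) c = mul h₄ a (mul h₃ b c)
  mul_comm : ∀ {i j n : ℤ} (h : i + j = n) (h' : j + i = n) (a : X i) (b : X j),
    mul h a b = (i * j).negOnePow • mul h' b a

namespace GrCommRing

attribute [instance] GrCommRing.grp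

/-- Homomorphisms of graded rings (of degree `0`, unital). -/
@[ext]
structure Hom (A B : GrCommRing.{u}) : Type u where
  toFun : ∀ i, A.X i →+ B.X i
  map_one : toFun 0 A.one = B.one
  map_mul : ∀ {i j n : ℤ} (h : i + j = n) (a : A.X i) (b : A.X j),
    toFun n (A.mul h a b) = B.mul h (toFun i a) (toFun j b)

instance : Category.{u} GrCommRing.{u} where
  Hom := Hom
  id A := ⟨fun _ => AddMonoidHom.id _, rfl, fun _ _ _ => rfl⟩
  comp f g := ⟨fun i => (g.toFun i).comp (f.toFun i),
    by simp [f.map_one, g.map_one], fun h a b => by simp [f.map_mul h, g.map_mul h]⟩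

end GrCommRing

/-- The category `Alg_k` of graded commutative `k`-algebras: graded commutative rings
under `k`. -/
abbrev GrAlg (k : GrCommRing.{u}) : Type (u + 1) := Under k

/-- A graded right module over the graded commutative ring `l`. -/
structure GrMod (l : GrCommRing.{u}) : Type (u + 1) where
  X : ℤ → Type u
  [grp : ∀ p, AddCommGroup (X p)]
  act : ∀ {p i q : ℤ}, p + i = q → X p →+ l.X i →+ X q
  act_one : ∀ {p : ℤ} (x : X p), act (add_zero p) x l.one = x
  act_act : ∀ {p i j q m r : ℤ} (h₁ : p + i = q) (h₂ : q + j = r) (h₃ : i + j = m)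
    (h₄ : p + m = r) (x : X p) (a : l.X i) (b : l.X j),
    act h₂ (act h₁ x a) b = act h₄ x (l.mul h₃ a b)

namespace GrMod

attribute [instance] GrMod.grp

/-- Homomorphisms of graded modules (of degree `0`). -/
@[ext]
structure Hom {l : GrCommRing.{u}} (M N : GrMod l) : Type u where
  toFun : ∀ p, M.X p →+ N.X p
  map_act : ∀ {p i q : ℤ} (h : p + i = q) (x : M.X p) (a : l.X i),
    toFun q (M.act h x a) = N.act h (toFun p x) a

instance (l : GrCommRing.{u}) : Category.{u} (GrMod l) where
  Hom := Hom
  id M := ⟨fun _ => AddMonoidHom.id _, fun _ _ _ => rfl⟩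
  comp f g := ⟨fun p => (g.toFun p).comp (f.toFun p),
    fun h x a => by simp [f.map_act h, g.map_act h]⟩

/-- The underlying graded set of a graded module. -/
@[simps]
def forget (l : GrCommRing.{u}) : GrMod l ⥤ GradedObject ℤ (Type u) where
  obj M := M.X
  map f := fun p => ↾(f.toFun p)

end GrMod

/-- The product of graded sets, `(S × T)(n) = ∐_{p + q = n} S(p) × T(q)`. -/
def grProd (S T : GradedObject ℤ (Type u)) : GradedObject ℤ (Type u) :=
  fun n => Σ d : {d : ℤ × ℤ // d.1 + d.2 = n}, S d.1.1 × T d.1.2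

/-- The element `(x, y)` of degree `n = p + q` of a product of graded sets. -/
def grPair {S T : GradedObject ℤ (Type u)} {p q n : ℤ} (h : p + q = n) (x : S p) (y : T q) :
    grProd S T n :=
  ⟨⟨(p, q), h⟩, x, y⟩

/-- The map `f × g` on products of graded sets. -/
def grProdMap {S S' T T' : GradedObject ℤ (Type u)} (f : S ⟶ S') (g : T ⟶ T') :
    grProd S T ⟶ grProd S' T' :=
  fun _ => ↾(fun z => grPair z.1.2 (f z.1.1.1 z.2.1) (g z.1.1.2 z.2.2))

/-- A map of graded sets `M × N → P` between graded right `l`-modules is `l`-bilinear if it is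
additive in each variable, `φ(x, y a) = φ(x, y) a`, and
`φ(x a, y) = (-1) ^ (|a| |y|) φ(x, y) a`. -/
structure IsGrBilinear {l : GrCommRing.{u}} {M N P : GrMod l}
    (φ : ∀ {p q n : ℤ}, p + q = n → M.X p → N.X q → P.X n) : Prop where
  add_left : ∀ {p q n : ℤ} (h : p + q = n) (x x' : M.X p) (y : N.X q),
    φ h (x + x') y = φ h x y + φ h x' y
  add_right : ∀ {p q n : ℤ} (h : p + q = n) (x : M.X p) (y y' : N.X q),
    φ h x (y + y') = φ h x y + φ h x y'
  act_right : ∀ {p q i n q' m : ℤ} (h : p + q = n) (h₁ : q + i = q') (h₂ : p + q' = m)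
    (h₃ : n + i = m) (x : M.X p) (y : N.X q) (a : l.X i),
    φ h₂ x (N.act h₁ y a) = P.act h₃ (φ h x y) a
  act_left : ∀ {p q i n p' m : ℤ} (h : p + q = n) (h₁ : p + i = p') (h₂ : p' + q = m)
    (h₃ : n + i = m) (x : M.X p) (y : N.X q) (a : l.X i),
    φ h₂ (M.act h₁ x a) y = (i * q).negOnePow • P.act h₃ (φ h x y) a

namespace GrMod

variable {l : GrCommRing.{u}}

/-- The relations defining the degree `n` part of the tensor product `M ⊗_l N` as a quotient of the
free abelian group on the pairs `(x, y)` with `|x| + |y| = n`. -/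
inductive TensorRel (M N : GrMod l) (n : ℤ) :
    FreeAbelianGroup (grProd M.X N.X n) → Prop
  | add_left {p q : ℤ} (h : p + q = n) (x x' : M.X p) (y : N.X q) :
      TensorRel M N n (.of (grPair h (x + x') y) - .of (grPair h x y) - .of (grPair h x' y))
  | add_right {p q : ℤ} (h : p + q = n) (x : M.X p) (y y' : N.X q) :
      TensorRel M N n (.of (grPair h x (y + y')) - .of (grPair h x y) - .of (grPair h x y'))
  | balanced {p q i p' q' : ℤ} (h₁ : p + i = p') (h₂ : p' + q = n) (h₃ : q + i = q')
      (h₄ : p + q' = n) (x : M.X p) (y : N.X q) (a : l.X i) :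
      TensorRel M N n (.of (grPair h₂ (M.act h₁ x a) y)
        - (i * q).negOnePow • .of (grPair h₄ x (N.act h₃ y a)))

/-- The degree `n` part of the tensor product `M ⊗_l N`. -/
abbrev TensorX (M N : GrMod l) (n : ℤ) : Type u :=
  FreeAbelianGroup (grProd M.X N.X n) ⧸ AddSubgroup.closure {z | TensorRel M N n z}

/-- The pure tensor `x ⊗ y`. -/
def tmul (M N : GrMod l) {p q n : ℤ} (h : p + q = n) (x : M.X p) (y : N.X q) :
    TensorX M N n :=
  QuotientAddGroup.mk (.of (grPair h x y))

section

variable (M N : GrMod l)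

theorem tmul_add_left {p q n : ℤ} (h : p + q = n) (x x' : M.X p) (y : N.X q) :
    tmul M N h (x + x') y = tmul M N h x y + tmul M N h x' y := by
  have := (QuotientAddGroup.eq_zero_iff _).2
    (AddSubgroup.subset_closure (TensorRel.add_left (M := M) (N := N) h x x' y))
  rw [sub_sub, QuotientAddGroup.mk_sub, sub_eq_zero] at this
  exact this

theorem tmul_add_right {p q n : ℤ} (h : p + q = n) (x : M.X p) (y y' : N.X q) :
    tmul M N h x (y + y') = tmul M N h x y + tmul M N h x y' := by
  have := (QuotientAddGroup.eq_zero_iff _).2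
    (AddSubgroup.subset_closure (TensorRel.add_right (M := M) (N := N) h x y y'))
  rw [sub_sub, QuotientAddGroup.mk_sub, sub_eq_zero] at this
  exact this

theorem tmul_balanced {p q i p' q' n : ℤ} (h₁ : p + i = p') (h₂ : p' + q = n) (h₃ : q + i = q')
    (h₄ : p + q' = n) (x : M.X p) (y : N.X q) (a : l.X i) :
    tmul M N h₂ (M.act h₁ x a) y = (i * q).negOnePow • tmul M N h₄ x (N.act h₃ y a) := by
  have := (QuotientAddGroup.eq_zero_iff _).2
    (AddSubgroup.subset_closure (TensorRel.balanced (M := M) (N := N) h₁ h₂ h₃ h₄ x y a))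
  rw [QuotientAddGroup.mk_sub, sub_eq_zero] at this
  exact this

variable {M N}

/-- The homomorphism out of `(M ⊗_l N)(n)` given by a biadditive balanced map on pairs. -/
def tensorLift {n : ℤ} {B : Type u} [AddCommGroup B]
    (f : ∀ p q : ℤ, p + q = n → M.X p → N.X q → B)
    (add_left : ∀ (p q : ℤ) (h : p + q = n) (x x' : M.X p) (y : N.X q),
      f p q h (x + x') y = f p q h x y + f p q h x' y)
    (add_right : ∀ (p q : ℤ) (h : p + q = n) (x : M.X p) (y y' : N.X q),
      f p q h x (y + y') = f p q h x y + f p q h x y')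
    (balanced : ∀ (p q i p' q' : ℤ) (h₁ : p + i = p') (h₂ : p' + q = n) (h₃ : q + i = q')
      (h₄ : p + q' = n) (x : M.X p) (y : N.X q) (a : l.X i),
      f p' q h₂ (M.act h₁ x a) y = (i * q).negOnePow • f p q' h₄ x (N.act h₃ y a)) :
    TensorX M N n →+ B :=
  QuotientAddGroup.lift _
    (FreeAbelianGroup.lift (fun z : grProd M.X N.X n => f z.1.1.1 z.1.1.2 z.1.2 z.2.1 z.2.2)) (by
      rw [AddSubgroup.closure_le]
      have key : ∀ {p q : ℤ} (h : p + q = n) (x : M.X p) (y : N.X q),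
          FreeAbelianGroup.lift
            (fun z : grProd M.X N.X n => f z.1.1.1 z.1.1.2 z.1.2 z.2.1 z.2.2)
            (.of (grPair h x y)) = f p q h x y :=
        fun h x y => FreeAbelianGroup.lift_apply_of _ _
      rintro _ (⟨h, x, x', y⟩ | ⟨h, x, y, y'⟩ | ⟨h₁, h₂, h₃, h₄, x, y, a⟩)
      · change FreeAbelianGroup.lift _ _ = 0
        rw [map_sub, map_sub, key, key, key, add_left]
        abel
      · change FreeAbelianGroup.lift _ _ = 0
        rw [map_sub, map_sub, key, key, key, add_right]
        abel
      · change FreeAbelianGroup.lift _ _ = 0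
        rw [map_sub, Units.smul_def, map_zsmul, key, key, balanced _ _ _ _ _ h₁ h₂ h₃ h₄,
          Units.smul_def, sub_self])

theorem tensor_hom_ext {n : ℤ} {B : Type u} [AddCommGroup B] {f g : TensorX M N n →+ B}
    (H : ∀ {p q : ℤ} (h : p + q = n) (x : M.X p) (y : N.X q),
      f (tmul M N h x y) = g (tmul M N h x y)) : f = g := by
  apply QuotientAddGroup.addMonoidHom_ext
  apply FreeAbelianGroup.lift_ext
  rintro ⟨⟨⟨p, q⟩, h⟩, x, y⟩
  exact H h x y

end

theorem tmul_zsmul_right (M N : GrMod l) {p q n : ℤ} (h : p + q = n) (c : ℤ) (x : M.X p)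
    (y : N.X q) : tmul M N h x (c • y) = c • tmul M N h x y :=
  map_zsmul (AddMonoidHom.mk' (tmul M N h x) (tmul_add_right M N h x)) c y

/-- Right multiplication by `a` on the tensor product, `(x ⊗ y) a = x ⊗ (y a)`. -/
def tensorAct (M N : GrMod l) {n i m : ℤ} (h : n + i = m) (a : l.X i) :
    TensorX M N n →+ TensorX M N m :=
  tensorLift
    (fun p q hn x y => tmul M N (by omega : p + (q + i) = m) x (N.act rfl y a))
    (fun p q hn x x' y => tmul_add_left M N _ x x' _)
    (fun p q hn x y y' => by rw [map_add, AddMonoidHom.add_apply, tmul_add_right])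
    (fun p q j p' q' h₁ h₂ h₃ h₄ x y b => by
      subst h₃
      have e : (l.mul rfl a b : l.X (i + j)) = (i * j).negOnePow • l.mul (add_comm j i) b a :=
        l.mul_comm _ _ a b
      have e' : (j * (q + i)).negOnePow * (i * j).negOnePow = (j * q).negOnePow := by
        rw [← Int.negOnePow_add, Int.negOnePow_eq_iff]
        exact ⟨i * j, by ring⟩
      have hq : q + j + i = q + i + j := by ring
      rw [tmul_balanced M N h₁ _ (rfl : q + i + j = _) (by omega),
        N.act_act rfl rfl rfl (by omega), e, Units.smul_def, Units.smul_def, map_zsmul,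
        tmul_zsmul_right, ← Units.smul_def, ← Units.smul_def, smul_smul, e',
        ← N.act_act rfl hq (add_comm j i) (by omega)]
      congr 1
      have aux : ∀ {r s : ℤ} (hs : q + j + i = s) (hr : q + j + i = r) (h' : p + s = m)
          (h'' : p + r = m), tmul M N h' x (N.act hs (N.act rfl y b) a) =
            tmul M N h'' x (N.act hr (N.act rfl y b) a) := by
        intro r s hs hr h' h''
        subst hs
        subst hr
        rfl
      exact aux _ _ _ _)

theorem tensorAct_tmul (M N : GrMod l) {n i m p q q' : ℤ} (h : n + i = m) (a : l.X i)
    (hn : p + q = n) (hq : q + i = q') (hm : p + q' = m) (x : M.X p) (y : N.X q) :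
    tensorAct M N h a (tmul M N hn x y) = tmul M N hm x (N.act hq y a) := by
  subst hq
  exact FreeAbelianGroup.lift_apply_of _ _

/-- The tensor product `M ⊗_l N` of graded right `l`-modules. -/
def tensor (M N : GrMod l) : GrMod l where
  X := TensorX M N
  act {n i m} h := AddMonoidHom.flip (AddMonoidHom.mk' (fun a : l.X i => tensorAct M N h a) (by
    intro a b
    apply tensor_hom_ext
    intro p q hn x y
    rw [AddMonoidHom.add_apply, tensorAct_tmul M N h _ hn rfl (by omega),
      tensorAct_tmul M N h _ hn rfl (by omega), tensorAct_tmul M N h _ hn rfl (by omega),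
      map_add, tmul_add_right]))
  act_one {n} x := by
    change tensorAct M N (add_zero n) l.one x = AddMonoidHom.id _ x
    revert x
    apply DFunLike.congr_fun
    apply tensor_hom_ext
    intro p q hn x y
    rw [tensorAct_tmul M N _ _ hn (add_zero q) hn, N.act_one]
    rfl
  act_act {n i j r m t} h₁ h₂ h₃ h₄ x a b := by
    change tensorAct M N h₂ b (tensorAct M N h₁ a x) = tensorAct M N h₄ (l.mul h₃ a b) x
    rw [← AddMonoidHom.comp_apply]
    revert x
    apply DFunLike.congr_fun
    apply tensor_hom_ext
    intro p q hn x y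
    rw [AddMonoidHom.comp_apply, tensorAct_tmul M N h₁ a hn rfl (by omega),
      tensorAct_tmul M N h₂ b (by omega) (by omega : q + i + j = q + m) (by omega),
      tensorAct_tmul M N h₄ _ hn rfl (by omega), N.act_act _ _ h₃ rfl]

/-- The map `f ⊗ g` on the degree `n` part of a tensor product. -/
def tensorMapX {M M' N N' : GrMod l} (f : M ⟶ M') (g : N ⟶ N') (n : ℤ) :
    TensorX M N n →+ TensorX M' N' n :=
  tensorLift
    (fun p q hn x y => tmul M' N' hn (f.toFun p x) (g.toFun q y))
    (fun p q hn x x' y => by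
      rw [map_add]; exact tmul_add_left M' N' hn _ _ _)
    (fun p q hn x y y' => by rw [map_add]; exact tmul_add_right M' N' hn _ _ _)
    (fun p q i p' q' h₁ h₂ h₃ h₄ x y a => by
      rw [f.map_act, g.map_act]
      exact tmul_balanced M' N' h₁ h₂ h₃ h₄ _ _ a)

theorem tensorMapX_tmul {M M' N N' : GrMod l} (f : M ⟶ M') (g : N ⟶ N') {p q n : ℤ}
    (h : p + q = n) (x : M.X p) (y : N.X q) :
    tensorMapX f g n (tmul M N h x y) = tmul M' N' h (f.toFun p x) (g.toFun q y) :=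
  FreeAbelianGroup.lift_apply_of _ _

/-- The map `f ⊗ g` on tensor products. -/
def tensorMap {M M' N N' : GrMod l} (f : M ⟶ M') (g : N ⟶ N') : tensor M N ⟶ tensor M' N' where
  toFun n := tensorMapX f g n
  map_act {n i m} h x a := by
    change ((tensorMapX f g m).comp (tensorAct M N h a)) x =
      ((tensorAct M' N' h a).comp (tensorMapX f g n)) x
    revert x
    apply DFunLike.congr_fun
    apply tensor_hom_ext
    intro p q hn x y
    rw [AddMonoidHom.comp_apply, AddMonoidHom.comp_apply,
      tensorAct_tmul M N h a hn rfl (by omega), tensorMapX_tmul, tensorMapX_tmul,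
      tensorAct_tmul M' N' h a hn rfl (by omega), g.map_act]

end GrMod

/-- The functor sending an algebra `R` to the objectwise tensor product `F(R) ⊗_l G(R)`. -/
def objTensor {k l : GrCommRing.{u}} (F G : GrAlg k ⥤ GrMod l) : GrAlg k ⥤ GrMod l where
  obj R := GrMod.tensor (F.obj R) (G.obj R)
  map f := GrMod.tensorMap (F.map f) (G.map f)
  map_id R := by
    apply GrMod.Hom.ext
    funext n
    apply GrMod.tensor_hom_ext
    intro p q h x y
    refine (GrMod.tensorMapX_tmul _ _ h x y).trans ?_
    rw [F.map_id, G.map_id]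
    rfl
  map_comp f g := by
    apply GrMod.Hom.ext
    funext n
    apply GrMod.tensor_hom_ext
    intro p q h x y
    refine (GrMod.tensorMapX_tmul _ _ h x y).trans ?_
    rw [F.map_comp, G.map_comp]
    refine Eq.symm ((congrArg (GrMod.tensorMapX (F.map g) (G.map g) n)
      (GrMod.tensorMapX_tmul (F.map f) (G.map f) h x y)).trans ?_)
    exact GrMod.tensorMapX_tmul _ _ h _ _

/-- The functor sending an algebra `R` to the product of the graded sets `S(R)` and `T(R)`. -/
def objProd {k : GrCommRing.{u}} (S T : GrAlg k ⥤ GradedObject ℤ (Type u)) :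
    GrAlg k ⥤ GradedObject ℤ (Type u) where
  obj R := grProd (S.obj R) (T.obj R)
  map f := grProdMap (S.map f) (T.map f)
  map_id R := by
    funext n
    ext z
    simp [grProdMap, grPair]
    rfl
  map_comp f g := by
    funext n
    ext z
    simp [grProdMap, grPair]
    rfl

/-- The natural transformation `σ × τ`. -/
def objProdMap {k : GrCommRing.{u}} {S S' T T' : GrAlg k ⥤ GradedObject ℤ (Type u)}
    (σ : S ⟶ S') (τ : T ⟶ T') : objProd S T ⟶ objProd S' T' where
  app R := grProdMap (σ.app R) (τ.app R)
  naturality R R' f := by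
    funext n
    ext ⟨⟨⟨p, q⟩, h⟩, x, y⟩
    have e₁ := ConcreteCategory.congr_hom (congrFun (σ.naturality f) p) x
    have e₂ := ConcreteCategory.congr_hom (congrFun (τ.naturality f) q) y
    exact congrArg₂ (grPair h) e₁ e₂

/-- The functor to graded sets underlying a functor to graded `l`-modules. -/
abbrev und {k l : GrCommRing.{u}} (F : GrAlg k ⥤ GrMod l) : GrAlg k ⥤ GradedObject ℤ (Type u) :=
  F ⋙ GrMod.forget l

/-- The natural transformation of functors to graded sets underlying a natural transformation
of functors to graded `l`-modules. -/
abbrev undMap {k l : GrCommRing.{u}} {F G : GrAlg k ⥤ GrMod l} (σ : F ⟶ G) : und F ⟶ und G :=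
  Functor.whiskerRight σ (GrMod.forget l)

/-- A natural transformation `F × G → H` is `l`-bilinear if it is so on every algebra `R`. -/
def IsBilinear {k l : GrCommRing.{u}} {F G H : GrAlg k ⥤ GrMod l}
    (φ : objProd (und F) (und G) ⟶ und H) : Prop :=
  ∀ R : GrAlg k, IsGrBilinear (M := F.obj R) (N := G.obj R) (P := H.obj R)
    (fun {_ _ n} h x y => (φ.app R) n (grPair h x y))

/-- The natural `l`-bilinear map `F(R) × G(R) → F(R) ⊗_l G(R)`, `(x, y) ↦ x ⊗ y`. -/
def objTmul {k l : GrCommRing.{u}} (F G : GrAlg k ⥤ GrMod l) :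
    objProd (und F) (und G) ⟶ und (objTensor F G) where
  app R := fun _ => ↾(fun z => GrMod.tmul (F.obj R) (G.obj R) z.1.2 z.2.1 z.2.2)
  naturality R R' f := by
    funext n
    ext ⟨⟨⟨p, q⟩, h⟩, x, y⟩
    exact (GrMod.tensorMapX_tmul (F.map f) (G.map f) h x y).symm

/-- A functor from graded commutative `k`-algebras to graded sets is ind-representable if in each
degree it is a small filtered colimit of representable functors. -/
def IsIndRep {k : GrCommRing.{u}} : ObjectProperty (GrAlg k ⥤ GradedObject ℤ (Type u)) :=
  fun S => ∀ n : ℤ, IsIndObject (unopUnop (GrAlg k) ⋙ S ⋙ GradedObject.eval n)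

/-- The category `Sch_k` of (graded) formal schemes over `k`. -/
abbrev FSch (k : GrCommRing.{u}) := (IsIndRep (k := k)).FullSubcategory

/-- The category `fModSch_k^l` of formal `l`-module schemes over `k`: ind-representable functors
from graded commutative `k`-algebras to graded `l`-modules, and all natural transformations. -/
abbrev FModSch (k l : GrCommRing.{u}) :=
  ObjectProperty.FullSubcategory (fun F : GrAlg k ⥤ GrMod l => IsIndRep (und F))

/-- The forgetful functor `V : fModSch_k^l → Sch_k`. -/
def FModSch.forget (k l : GrCommRing.{u}) : FModSch k l ⥤ FSch k where
  obj F := ⟨und F.obj, F.property⟩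
  map σ := ObjectProperty.homMk (undMap σ.hom)

/-- A natural transformation `υ : F × G → T` of functors to graded sets exhibits the formal module
scheme `T` as universal for `l`-bilinear maps: every `l`-bilinear natural transformation
`F × G → H` to a formal module scheme `H` factors uniquely through a morphism `T → H`. -/
def IsUniversalBilinear {k l : GrCommRing.{u}} {F G T : FModSch k l}
    (υ : objProd (und F.obj) (und G.obj) ⟶ und T.obj) : Prop :=
  ∀ (H : FModSch k l) (φ : objProd (und F.obj) (und G.obj) ⟶ und H.obj), IsBilinear φ →
    ∃! f : T ⟶ H, υ ≫ undMap f.hom = φ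

/-- The formal module scheme `T` represents the objectwise tensor product among formal module
schemes via `υ`: the map `υ` extends to a natural transformation
`t : F(-) ⊗_l G(-) → T` of functors to graded `l`-modules, and composition with `t` is a bijection
from morphisms `T → H` to natural transformations `F(-) ⊗_l G(-) → H`, for each formal module
scheme `H`. -/
def RepresentsObjTensor {k l : GrCommRing.{u}} {F G T : FModSch k l}
    (υ : objProd (und F.obj) (und G.obj) ⟶ und T.obj) : Prop :=
  ∃ t : objTensor F.obj G.obj ⟶ T.obj, objTmul F.obj G.obj ≫ undMap t = υ ∧
    ∀ H : FModSch k l, Function.Bijective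
      (fun f : T ⟶ H => (t ≫ f.hom : objTensor F.obj G.obj ⟶ H.obj))

/-- A natural transformation `π : S → P` exhibits the formal scheme `P` as the best ind-representable
approximation of the functor `S`: every natural transformation from `S` to a formal scheme factors
uniquely through `P`. For `S = F × G` this says that `P` is the product of `F` and `G` as graded
formal schemes. -/
def IsFormalApprox {k : GrCommRing.{u}} {S : GrAlg k ⥤ GradedObject ℤ (Type u)} {P : FSch k}
    (π : S ⟶ P.obj) : Prop :=
  ∀ (Y : FSch k) (φ : S ⟶ Y.obj), ∃! f : P ⟶ Y, π ≫ f.hom = φ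

/-! The tensor product is obtained as the solution of a universal problem, by an argument in the
style of the adjoint functor theorem. A set-valued functor on algebras is a small filtered colimit
of representables exactly when it is left exact (preserves the terminal object and pullbacks) and is
generated by its elements over a small family of algebras (`isIndObject_of_isLex`,
`isLex_and_exists_isGeneratedBy`). Products of left exact functors are again left exact, so only
smallness is at stake.

Smallness is restored by passing to generated subfunctors. Fix a small family of algebras that is
closed under pullbacks and in which any two members mapping to `R` factor through a member that is a
subobject of `R` (`GrAlg.exists_isSaturated`). If `X` is generated over this family and `φ : X ⟶ und
H` has left exact target, then closing the values of `φ` over the family under module operations,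
functoriality and glueing along pullbacks gives a left exact, small subfunctor `genClosure`, that
is, a formal module scheme. A morphism from it to a left exact functor is determined on `X`
(`genClosure_hom_ext`).

Elements of `genClosure` are values of formal expressions (`GenTerm`), which do not depend on `H`.
The relation "equal value" on expressions determines which maps out of `genClosure` exist
(`GenTerm.exists_hom_of_rel_eq`), and there is only a small set of such relations. Choosing one `φ`
for each relation, and closing up the image of `X` in the product of the generated subfunctors,
yields a universal map out of `X` (`exists_universal`). With `X = F × G` and bilinear maps this is
the tensor product; with `X` a formal scheme and no condition it is the free formal module scheme.

For the coequalizer, take the kernel pair `X` of `q : Fr P ⟶ F ⊗ G` on underlying formal schemes. A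
map out of `Fr P` that coequalizes the two maps from `Fr X` respects every identification made by
`q`, hence restricts to a bilinear map on `F × G`, and so factors through `F ⊗ G`. -/

/-! ### Ind-representable functors as small left exact functors. -/

section LeftExact

variable {C : Type (u + 1)} [Category.{u} C]

/-- A set-valued functor is left exact if it takes terminal objects to one-point sets and pullback
squares to pullback squares. -/
structure IsLex (S : C ⥤ Type u) : Prop where
  terminal : ∀ {R : C}, IsTerminal R → ∃ x : S.obj R, ∀ y : S.obj R, y = x
  exists_glue : ∀ {A B B' D : C} {p : A ⟶ B} {p' : A ⟶ B'} {f : B ⟶ D} {f' : B' ⟶ D},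
    IsPullback p p' f f' → ∀ (x : S.obj B) (x' : S.obj B'), S.map f x = S.map f' x' →
      ∃ z : S.obj A, S.map p z = x ∧ S.map p' z = x'
  hom_ext : ∀ {A B B' D : C} {p : A ⟶ B} {p' : A ⟶ B'} {f : B ⟶ D} {f' : B' ⟶ D},
    IsPullback p p' f f' → ∀ z z' : S.obj A, S.map p z = S.map p z' →
      S.map p' z = S.map p' z' → z = z'

/-- The kernel pair of a monomorphism is trivial, and left exactness applies to that pullback
square. This is what allows an equation over `R` to be checked over a subobject of `R`. -/
theorem IsLex.injective {S : C ⥤ Type u} (hS : IsLex S) {A B : C} (f : A ⟶ B) [Mono f] :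
    Function.Injective (S.map f) := by
  intro x y h
  obtain ⟨z, hz, hz'⟩ := hS.exists_glue (IsKernelPair.id_of_mono f) x y h
  simp only [S.map_id, types_id_apply] at hz hz'
  exact hz.symm.trans hz'

theorem IsLex.preservesFiniteLimits [HasTerminal C] [HasPullbacks C] {S : C ⥤ Type u}
    (hS : IsLex S) : PreservesFiniteLimits S := by
  have h₁ : PreservesLimitsOfShape (Discrete.{0} PEmpty) S := by
    have : PreservesLimit (Functor.empty.{0} C) S := by
      obtain ⟨x, hx⟩ := hS.terminal (terminalIsTerminal (C := C))
      exact preservesTerminal_of_iso S (IsTerminal.uniqueUpToIso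
        ((Types.isTerminalEquivUnique _).symm ⟨⟨x⟩, hx⟩) terminalIsTerminal)
    exact preservesLimitsOfShape_pempty_of_preservesTerminal S
  have h₂ : PreservesLimitsOfShape WalkingCospan S := by
    refine preservesLimitsOfShape_walkingCospan_of_forall_isPullback fun X Y Z f g _ => ?_
    have sq := IsPullback.of_hasPullback f g
    refine ⟨_, _, _, sq, (Types.isPullback_iff _ _ _ _).2 ⟨?_, ?_, ?_⟩⟩
    · rw [← S.map_comp, ← S.map_comp, pullback.condition]
    · exact fun z z' h => hS.hom_ext sq z z' h.1 h.2
    · exact fun x y h => hS.exists_glue sq x y h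
  exact preservesFiniteLimits_of_preservesTerminal_and_pullbacks S

/-- A family of objects generates a set-valued functor if every element is the image of an element
over a member of the family. -/
def IsGeneratedBy {ι : Type u} (ob : ι → C) (S : C ⥤ Type u) : Prop :=
  ∀ (R : C) (s : S.obj R), ∃ (i : ι) (f : ob i ⟶ R) (x : S.obj (ob i)), S.map f x = s

/-- Left exactness makes the category of elements filtered; the generating family makes it finally
small. -/
theorem isIndObject_of_isLex [HasTerminal C] [HasPullbacks C] {S : C ⥤ Type u} (hS : IsLex S)
    {ι : Type u} {ob : ι → C} (h : IsGeneratedBy ob S) : IsIndObject (unopUnop C ⋙ S) := by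
  have : HasFiniteLimits C := hasFiniteLimits_of_hasTerminal_and_pullbacks
  have := hS.preservesFiniteLimits
  have : PreservesFiniteLimits (unopUnop C ⋙ S) := comp_preservesFiniteLimits _ _
  have := isFiltered_costructuredArrow_yoneda_of_preservesFiniteLimits (unopUnop C ⋙ S)
  -- The elements over members of the family form a weakly terminal set: writing an element over `R`
  -- as the image of one over `ob i` is a morphism in the category of elements.
  have : FinallySmall.{u} (CostructuredArrow yoneda (unopUnop C ⋙ S)) := by
    let t : (Σ i, S.obj (ob i)) → CostructuredArrow yoneda (unopUnop C ⋙ S) := fun z =>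
      CostructuredArrow.mk (Y := Opposite.op (ob z.1)) (yonedaEquiv.symm z.2)
    refine finallySmall_of_small_weakly_terminal_set (Set.range t) fun a => ?_
    obtain ⟨i, f, x, hx⟩ := h _ (yonedaEquiv a.hom)
    refine ⟨_, ⟨⟨i, x⟩, rfl⟩, ⟨CostructuredArrow.homMk f.op ?_⟩⟩
    apply yonedaEquiv.injective
    refine (yonedaEquiv_naturality _ _).symm.trans (Eq.trans ?_ hx)
    exact congrArg (S.map f) ((yonedaEquiv (F := unopUnop C ⋙ S)).apply_symm_apply x)
  exact isIndObject_of_isFiltered_of_finallySmall _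

/-- Filtered colimits of sets commute with finite limits, here carried out on elements; the
representing objects of a presentation form the generating family. -/
theorem isLex_and_exists_isGeneratedBy {S : C ⥤ Type u} (h : IsIndObject (unopUnop C ⋙ S)) :
    IsLex S ∧ ∃ (ι : Type u) (ob : ι → C), IsGeneratedBy ob S := by
  let P := h.presentation
  -- By Yoneda each coprojection is an element `u i`. The facts `surj` and `inj` are the description
  -- of a filtered colimit of sets in these terms.
  let u : ∀ i : P.I, S.obj (P.F.obj i).unop := fun i => yonedaEquiv (P.ι.app i)
  have hu : ∀ {i j : P.I} (t : i ⟶ j), S.map (P.F.map t).unop (u j) = u i := by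
    intro i j t
    refine (yonedaEquiv_naturality (P.ι.app j) (P.F.map t)).trans ?_
    exact congrArg yonedaEquiv ((P.ι.naturality t).trans (Category.comp_id _))
  have hι : ∀ (i : P.I) {R : C} (g : (P.F.obj i).unop ⟶ R),
      (P.ι.app i).app (Opposite.op (Opposite.op R)) g.op = S.map g (u i) :=
    fun i _ g => (map_yonedaEquiv (P.ι.app i) g.op).symm
  have hc : ∀ R : C, IsColimit (((evaluation _ _).obj (Opposite.op (Opposite.op R))).mapCocone P.cocone) :=
    fun R => isColimitOfPreserves _ P.isColimit
  have surj : ∀ {R : C} (s : S.obj R), ∃ (i : P.I) (g : (P.F.obj i).unop ⟶ R), S.map g (u i) = s := by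
    intro R s
    obtain ⟨i, g, hg⟩ := Types.jointly_surjective_of_isColimit (hc R) s
    exact ⟨i, Quiver.Hom.unop g, (hι i _).symm.trans hg⟩
  have inj : ∀ {R : C} (i : P.I) (g g' : (P.F.obj i).unop ⟶ R), S.map g (u i) = S.map g' (u i) →
      ∃ (j : P.I) (t : i ⟶ j), (P.F.map t).unop ≫ g = (P.F.map t).unop ≫ g' := by
    intro R i g g' hg
    have e := (Types.FilteredColimit.isColimit_eq_iff' (hc R) (i := i) g.op g'.op).1
      (((hι i g).trans hg).trans (hι i g').symm)
    obtain ⟨j, t, ht⟩ := e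
    exact ⟨j, t, Quiver.Hom.op_inj ht⟩
  have surj₂ : ∀ {R R' : C} (s : S.obj R) (s' : S.obj R'), ∃ (i : P.I)
      (g : (P.F.obj i).unop ⟶ R) (g' : (P.F.obj i).unop ⟶ R'),
        S.map g (u i) = s ∧ S.map g' (u i) = s' := by
    intro R R' s s'
    obtain ⟨i, g, rfl⟩ := surj s
    obtain ⟨i', g', rfl⟩ := surj s'
    refine ⟨IsFiltered.max i i', (P.F.map (IsFiltered.leftToMax i i')).unop ≫ g,
      (P.F.map (IsFiltered.rightToMax i i')).unop ≫ g', ?_, ?_⟩ <;>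
    rw [S.map_comp, types_comp_apply, hu]
  refine ⟨⟨fun {R} hR => ?_, ?_, ?_⟩, P.I, fun i => (P.F.obj i).unop, ?_⟩
  · obtain ⟨i⟩ := IsFiltered.nonempty (C := P.I)
    refine ⟨S.map (hR.from _) (u i), fun y => ?_⟩
    obtain ⟨j, g, g', rfl, h'⟩ := surj₂ y (S.map (hR.from _) (u i))
    rw [← h', hR.hom_ext g g']
  · intro A B B' D p p' f f' sq x x' hx
    obtain ⟨i, g, g', rfl, rfl⟩ := surj₂ x x'
    obtain ⟨j, t, ht⟩ := inj i (g ≫ f) (g' ≫ f') (by simpa using hx)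
    refine ⟨S.map (sq.lift ((P.F.map t).unop ≫ g) ((P.F.map t).unop ≫ g')
      (by simpa using ht)) (u j), ?_, ?_⟩
    · rw [← types_comp_apply, ← S.map_comp, sq.lift_fst, S.map_comp, types_comp_apply, hu]
    · rw [← types_comp_apply, ← S.map_comp, sq.lift_snd, S.map_comp, types_comp_apply, hu]
  · intro A B B' D p p' f f' sq z z' hz hz'
    obtain ⟨i, g, g', rfl, rfl⟩ := surj₂ z z'
    -- The index `j` equalizes the components in `B`, and the later index `j'` also those in `B'`;
    -- there the two maps into `A` agree.
    obtain ⟨j, t, ht⟩ := inj i (g ≫ p) (g' ≫ p) (by simpa using hz)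
    obtain ⟨j', t', ht'⟩ := inj j ((P.F.map t).unop ≫ g ≫ p') ((P.F.map t).unop ≫ g' ≫ p')
      (by simpa [hu] using hz')
    rw [← hu t, ← hu t']
    simp only [← types_comp_apply, ← S.map_comp]
    congr 3
    refine sq.hom_ext ?_ ?_
    · simp only [Category.assoc, ht]
    · simpa only [Category.assoc] using ht'
  · intro R s
    obtain ⟨i, g, hg⟩ := surj s
    exact ⟨i, g, u i, hg⟩

end LeftExact

/-! ### Graded rings and algebras: terminal object and pullbacks. -/

namespace GrCommRing

theorem hom_ext {A B : GrCommRing.{u}} {f g : A ⟶ B}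
    (h : ∀ (n : ℤ) (a : A.X n), f.toFun n a = g.toFun n a) : f = g :=
  Hom.ext (funext fun n => AddMonoidHom.ext (h n))

theorem mul_units_smul (A : GrCommRing.{u}) {i j n : ℤ} (h : i + j = n) (c : ℤˣ) (a : A.X i)
    (b : A.X j) : A.mul h a (c • b) = c • A.mul h a b := by
  rw [Units.smul_def, Units.smul_def, map_zsmul]

theorem units_smul_mul (A : GrCommRing.{u}) {i j n : ℤ} (h : i + j = n) (c : ℤˣ) (a : A.X i)
    (b : A.X j) : A.mul h (c • a) b = c • A.mul h a b := by
  rw [Units.smul_def, Units.smul_def, map_zsmul, AddMonoidHom.smul_apply]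

/-- The sign comes from moving `b` past `c`. The identity shows that products `f(a) g(b)` are closed
under multiplication up to sign. -/
theorem mul_mul_mul_comm (A : GrCommRing.{u}) {p q p' q' r r' s s' n : ℤ} (h₁ : p + q = r)
    (h₂ : p' + q' = r') (h : r + r' = n) (h₃ : p + p' = s) (h₄ : q + q' = s') (h' : s + s' = n)
    (a : A.X p) (b : A.X q) (c : A.X p') (d : A.X q') :
    A.mul h (A.mul h₁ a b) (A.mul h₂ c d) =
      (q * p').negOnePow • A.mul h' (A.mul h₃ a c) (A.mul h₄ b d) := by
  rw [A.mul_assoc h₁ h (rfl : q + r' = _) (by omega),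
    ← A.mul_assoc (rfl : q + p' = _) (by omega) h₂ rfl,
    A.mul_comm rfl (add_comm p' q) b c, units_smul_mul, mul_units_smul,
    A.mul_assoc (add_comm p' q) (by omega) h₄ (by omega),
    A.mul_assoc h₃ h' (by omega : p' + s' = q + r') (by omega)]

/-- A graded subring. -/
@[simps X]
def sub (A : GrCommRing.{u}) (S : ∀ n, AddSubgroup (A.X n)) (one_mem : A.one ∈ S 0)
    (mul_mem : ∀ {i j n : ℤ} (h : i + j = n) (a : A.X i) (b : A.X j), a ∈ S i → b ∈ S j →
      A.mul h a b ∈ S n) : GrCommRing.{u} where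
  X n := S n
  one := ⟨A.one, one_mem⟩
  mul h := AddMonoidHom.mk' (fun a => AddMonoidHom.mk'
      (fun b => ⟨A.mul h a.1 b.1, mul_mem h _ _ a.2 b.2⟩)
      (fun b b' => Subtype.ext (map_add (A.mul h a.1) b.1 b'.1)))
    (fun a a' => AddMonoidHom.ext fun b => Subtype.ext (by
      change A.mul h (a.1 + a'.1) b.1 = _
      rw [map_add]
      rfl))
  one_mul a := Subtype.ext (A.one_mul a.1)
  mul_assoc h₁ h₂ h₃ h₄ a b c := Subtype.ext (A.mul_assoc h₁ h₂ h₃ h₄ a.1 b.1 c.1)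
  mul_comm h h' a b := Subtype.ext (by
    refine (A.mul_comm h h' a.1 b.1).trans ?_
    rw [Units.smul_def, Units.smul_def, AddSubgroup.coe_zsmul]
    rfl)

/-- The product of two graded commutative rings. -/
@[simps X]
def prod (A B : GrCommRing.{u}) : GrCommRing.{u} where
  X n := A.X n × B.X n
  one := (A.one, B.one)
  mul h := AddMonoidHom.mk' (fun a => AddMonoidHom.mk'
      (fun b => (A.mul h a.1 b.1, B.mul h a.2 b.2))
      (fun b b' => Prod.ext (map_add (A.mul h a.1) b.1 b'.1) (map_add (B.mul h a.2) b.2 b'.2)))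
    (fun a a' => AddMonoidHom.ext fun b => Prod.ext
      (DFunLike.congr_fun (map_add (A.mul h) a.1 a'.1) b.1)
      (DFunLike.congr_fun (map_add (B.mul h) a.2 a'.2) b.2))
  one_mul a := Prod.ext (A.one_mul a.1) (B.one_mul a.2)
  mul_assoc h₁ h₂ h₃ h₄ a b c :=
    Prod.ext (A.mul_assoc h₁ h₂ h₃ h₄ a.1 b.1 c.1) (B.mul_assoc h₁ h₂ h₃ h₄ a.2 b.2 c.2)
  mul_comm h h' a b := Prod.ext (A.mul_comm h h' a.1 b.1) (B.mul_comm h h' a.2 b.2)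

/-- The zero ring. -/
@[simps X]
def zero : GrCommRing.{u} where
  X _ := PUnit
  one := ⟨⟩
  mul _ := 0
  one_mul _ := rfl
  mul_assoc _ _ _ _ _ _ _ := rfl
  mul_comm _ _ _ _ := rfl

end GrCommRing

namespace GrAlg

variable {k : GrCommRing.{u}}

/-- The action of an algebra homomorphism in degree `n`. -/
abbrev ev {A B : GrAlg k} (f : A ⟶ B) (n : ℤ) : A.right.X n →+ B.right.X n := f.right.toFun n

theorem hom_ext {A B : GrAlg k} {f g : A ⟶ B} (h : ∀ n a, ev f n a = ev g n a) : f = g :=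
  Under.UnderMorphism.ext (GrCommRing.hom_ext h)

theorem ev_algebraMap {A B : GrAlg k} (f : A ⟶ B) (n : ℤ) (a : k.X n) :
    ev f n (A.hom.toFun n a) = B.hom.toFun n a :=
  DFunLike.congr_fun (congrFun (congrArg GrCommRing.Hom.toFun (Under.w f)) n) a

theorem ev_comp {A B D : GrAlg k} (f : A ⟶ B) (g : B ⟶ D) (n : ℤ) (a : A.right.X n) :
    ev (f ≫ g) n a = ev g n (ev f n a) := rfl

theorem mono_of_injective {A B : GrAlg k} (f : A ⟶ B) (h : ∀ n, Function.Injective (ev f n)) :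
    Mono f where
  right_cancellation g g' e := hom_ext fun n a => h n
    ((ev_comp g f n a).symm.trans ((congrArg (fun m => ev m n a) e).trans (ev_comp g' f n a)))

/-- An algebra homomorphism built from its components; preservation of the unit follows from
compatibility with the structure maps. -/
def homMk {A B : GrAlg k} (φ : ∀ n, A.right.X n →+ B.right.X n)
    (map_mul : ∀ {i j n : ℤ} (h : i + j = n) (a : A.right.X i) (b : A.right.X j),
      φ n (A.right.mul h a b) = B.right.mul h (φ i a) (φ j b))
    (map_algebraMap : ∀ (n : ℤ) (a : k.X n), φ n (A.hom.toFun n a) = B.hom.toFun n a) : A ⟶ B :=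
  Under.homMk ⟨φ, by
      have h := map_algebraMap 0 k.one
      rwa [A.hom.map_one, B.hom.map_one] at h, map_mul⟩
    (GrCommRing.hom_ext map_algebraMap)

/-- The zero algebra is terminal. -/
def isTerminalZero : IsTerminal (Under.mk
    (⟨fun _ => 0, rfl, fun _ _ _ => rfl⟩ : k ⟶ GrCommRing.zero) : GrAlg k) :=
  IsTerminal.ofUniqueHom (fun _ => homMk (fun _ => 0) (fun _ _ _ => rfl) (fun _ _ => rfl))
    (fun _ _ => hom_ext fun _ _ => rfl)

instance : HasTerminal (GrAlg k) := isTerminalZero.hasTerminal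

/-- The pullback of graded commutative rings underlying a pullback of algebras. -/
def pullbackRing {A B D : GrAlg k} (f : A ⟶ D) (g : B ⟶ D) : GrCommRing.{u} :=
  (GrCommRing.prod A.right B.right).sub
    (fun n =>
      { carrier := {x : A.right.X n × B.right.X n | ev f n x.1 = ev g n x.2}
        zero_mem' := (map_zero (ev f n)).trans (map_zero (ev g n)).symm
        add_mem' := fun {x y} hx hy => (map_add (ev f n) x.1 y.1).trans
          ((congrArg₂ (· + ·) hx hy).trans (map_add (ev g n) x.2 y.2).symm)
        neg_mem' := fun {x} hx => (map_neg (ev f n) x.1).trans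
          ((congrArg Neg.neg hx).trans (map_neg (ev g n) x.2).symm) })
    (f.right.map_one.trans g.right.map_one.symm)
    (fun h a b ha hb => by
      refine (f.right.map_mul h a.1 b.1).trans (Eq.trans ?_ (g.right.map_mul h a.2 b.2).symm)
      exact congrArg₂ (fun x y => D.right.mul h x y) ha hb)

/-- The pullback of graded algebras. -/
def pullback {A B D : GrAlg k} (f : A ⟶ D) (g : B ⟶ D) : GrAlg k :=
  Under.mk (Y := pullbackRing f g)
    ⟨fun n => AddMonoidHom.mk' (fun a => ⟨(A.hom.toFun n a, B.hom.toFun n a),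
        (ev_algebraMap f n a).trans (ev_algebraMap g n a).symm⟩)
        (fun a b => Subtype.ext (Prod.ext (map_add _ a b) (map_add _ a b))),
      Subtype.ext (Prod.ext A.hom.map_one B.hom.map_one),
      fun h a b => Subtype.ext (Prod.ext (A.hom.map_mul h a b) (B.hom.map_mul h a b))⟩

/-- The first projection of a pullback. -/
def pullbackFst {A B D : GrAlg k} (f : A ⟶ D) (g : B ⟶ D) : pullback f g ⟶ A :=
  homMk (A := pullback f g)
    (fun n => AddMonoidHom.mk' (fun x : (pullbackRing f g).X n => x.1.1) (fun _ _ => rfl))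
    (fun _ _ _ => rfl) (fun _ _ => rfl)

/-- The second projection of a pullback. -/
def pullbackSnd {A B D : GrAlg k} (f : A ⟶ D) (g : B ⟶ D) : pullback f g ⟶ B :=
  homMk (A := pullback f g)
    (fun n => AddMonoidHom.mk' (fun x : (pullbackRing f g).X n => x.1.2) (fun _ _ => rfl))
    (fun _ _ _ => rfl) (fun _ _ => rfl)

theorem isPullback {A B D : GrAlg k} (f : A ⟶ D) (g : B ⟶ D) :
    IsPullback (pullbackFst f g) (pullbackSnd f g) f g := by
  have w : pullbackFst f g ≫ f = pullbackSnd f g ≫ g := 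
    hom_ext fun n (a : (pullbackRing f g).X n) => a.2
  refine ⟨⟨w⟩, ⟨PullbackCone.IsLimit.mk w (fun s => ?_) ?_ ?_ ?_⟩⟩
  · have hs : ∀ n a, ev f n (ev s.fst n a) = ev g n (ev s.snd n a) := fun n a =>
      congrArg (fun m => ev m n a) s.condition
    exact homMk (B := pullback f g) (fun n => AddMonoidHom.mk'
        (fun a => (⟨(ev s.fst n a, ev s.snd n a), hs n a⟩ : (pullbackRing f g).X n))
        (fun a b => Subtype.ext (Prod.ext (map_add _ a b) (map_add _ a b))))
      (fun h a b => Subtype.ext (Prod.ext (s.fst.right.map_mul h a b) (s.snd.right.map_mul h a b)))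
      (fun n a => Subtype.ext (Prod.ext (ev_algebraMap s.fst n a) (ev_algebraMap s.snd n a)))
  · exact fun s => rfl
  · exact fun s => rfl
  · intro s m hm hm'
    exact hom_ext fun n a => Subtype.ext (Prod.ext
      (congrArg (fun m => ev m n a) hm) (congrArg (fun m => ev m n a) hm'))

instance : HasPullbacks (GrAlg k) :=
  have : ∀ {A B D : GrAlg k} {f : A ⟶ D} {g : B ⟶ D}, HasLimit (cospan f g) :=
    fun {_ _ _ f g} => (isPullback f g).hasPullback
  hasPullbacks_of_hasLimit_cospan _

end GrAlg

/-! ### Small saturated families of algebras. -/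

/-- A small family of objects of a category is saturated if every object receives a morphism from
a member of the family, any two morphisms from members to an object factor through
a monomorphism from a member, and the family is closed under pullbacks. -/
structure IsSaturated {C : Type (u + 1)} [Category.{u} C] {ι : Type u} (ob : ι → C) : Prop where
  exists_hom : ∀ R : C, ∃ i, Nonempty (ob i ⟶ R)
  exists_mono : ∀ {R : C} {i j : ι} (f : ob i ⟶ R) (g : ob j ⟶ R),
    ∃ (m : ι) (h : ob m ⟶ R) (f' : ob i ⟶ ob m) (g' : ob j ⟶ ob m),
      Mono h ∧ f' ≫ h = f ∧ g' ≫ h = g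
  exists_isPullback : ∀ {i j m : ι} (f : ob i ⟶ ob m) (g : ob j ⟶ ob m),
    ∃ (n : ι) (p : ob n ⟶ ob i) (q : ob n ⟶ ob j), IsPullback p q f g

section Cardinality

open Cardinal

/-- The closure embeds in the image of the free abelian group on `s`, whose cardinality formula
needs `s` nonempty. -/
theorem mk_addSubgroupClosure_le {G : Type u} [AddCommGroup G] (s : Set G) {κ : Cardinal.{u}}
    (hκ : ℵ₀ ≤ κ) (hs : #s ≤ κ) : #(AddSubgroup.closure s) ≤ κ := by
  rcases isEmpty_or_nonempty s with h | h
  · rw [Set.isEmpty_coe_sort] at h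
    subst h
    rw [AddSubgroup.closure_empty]
    exact (le_one_iff_subsingleton.2 inferInstance).trans (one_le_aleph0.trans hκ)
  · let φ : FreeAbelianGroup s →+ G := FreeAbelianGroup.lift Subtype.val
    have hφ : AddSubgroup.closure s ≤ φ.range := by
      rw [AddSubgroup.closure_le]
      exact fun x hx => ⟨.of ⟨x, hx⟩, FreeAbelianGroup.lift_apply_of _ _⟩
    refine (mk_le_of_injective (AddSubgroup.inclusion_injective hφ)).trans ?_
    refine (mk_le_of_surjective φ.rangeRestrict_surjective).trans ?_
    rw [mk_freeAbelianGroup]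
    exact max_le hs hκ

theorem mk_grProd_le {S T : GradedObject ℤ (Type u)} {κ : Cardinal.{u}} (hκ : ℵ₀ ≤ κ)
    (hS : ∀ n, #(S n) ≤ κ) (hT : ∀ n, #(T n) ≤ κ) (n : ℤ) : #(grProd S T n) ≤ κ := by
  have e : ∀ p, Nonempty (S p ↪ κ.out) := fun p => by
    have := hS p
    rwa [← mk_out κ] at this
  have e' : ∀ q, Nonempty (T q ↪ κ.out) := fun q => by
    have := hT q
    rwa [← mk_out κ] at this
  have h : Function.Injective (fun z : grProd S T n =>
      ((ULift.up.{u} z.1.1, (e z.1.1.1).some z.2.1, (e' z.1.1.2).some z.2.2) :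
        ULift.{u} (ℤ × ℤ) × κ.out × κ.out)) := by
    rintro ⟨⟨d, hd⟩, x, y⟩ ⟨⟨d', hd'⟩, x', y'⟩ h
    simp only [Prod.mk.injEq, ULift.up.injEq] at h
    obtain ⟨rfl, hx, hy⟩ := h
    rw [(e _).some.injective hx, (e' _).some.injective hy]
  refine (mk_le_of_injective h).trans ?_
  rw [mk_prod, mk_prod]
  simp only [lift_id, mk_out]
  exact mul_le_of_le hκ (mk_le_aleph0.trans hκ) (mul_le_of_le hκ le_rfl le_rfl)

end Cardinality

namespace GrAlg

variable {k : GrCommRing.{u}}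

section Generated

variable {A B R : GrAlg k} (f : A ⟶ R) (g : B ⟶ R)

/-- The additive generators of the subalgebra generated by the images of two algebras. -/
def joinGen (n : ℤ) : Set (R.right.X n) :=
  Set.range fun z : grProd A.right.X B.right.X n =>
    R.right.mul z.1.2 (ev f _ z.2.1) (ev g _ z.2.2)

/-- The subring of `R` generated by the images of `A` and `B`. -/
def joinRing : GrCommRing.{u} :=
  R.right.sub (fun n => AddSubgroup.closure (joinGen f g n))
    (AddSubgroup.subset_closure ⟨grPair (zero_add 0) A.right.one B.right.one, by
      refine (congrArg₂ (fun x y => R.right.mul _ x y) f.right.map_one g.right.map_one).trans ?_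
      exact R.right.one_mul _⟩)
    (fun {i j n} h a b ha hb => by
      induction ha using AddSubgroup.closure_induction with
      | zero => rw [map_zero]; exact AddSubgroup.zero_mem _
      | add x y _ _ hx hy => rw [map_add]; exact AddSubgroup.add_mem _ hx hy
      | neg x _ hx => rw [map_neg]; exact AddSubgroup.neg_mem _ hx
      | mem x hx =>
        induction hb using AddSubgroup.closure_induction with
        | zero => rw [map_zero]; exact AddSubgroup.zero_mem _
        | add y z _ _ hy hz => rw [map_add]; exact AddSubgroup.add_mem _ hy hz
        | neg y _ hy => rw [map_neg]; exact AddSubgroup.neg_mem _ hy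
        | mem y hy =>
          obtain ⟨⟨⟨⟨p, q⟩, h₁⟩, a, b⟩, rfl⟩ := hx
          obtain ⟨⟨⟨⟨p', q'⟩, h₂⟩, c, d⟩, rfl⟩ := hy
          dsimp only at h₁ h₂ ⊢
          rw [R.right.mul_mul_mul_comm h₁ h₂ h rfl rfl (by omega), Units.smul_def]
          apply AddSubgroup.zsmul_mem
          apply AddSubgroup.subset_closure
          refine ⟨grPair (by omega : (p + p') + (q + q') = n) (A.right.mul rfl a c)
            (B.right.mul rfl b d), ?_⟩
          exact congrArg₂ (fun x y => R.right.mul _ x y) (f.right.map_mul rfl a c)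
            (g.right.map_mul rfl b d))

theorem left_mem_joinRing (n : ℤ) (a : A.right.X n) :
    ev f n a ∈ AddSubgroup.closure (joinGen f g n) :=
  AddSubgroup.subset_closure ⟨grPair (add_zero n) a B.right.one, by
    refine (congrArg (fun y => R.right.mul (add_zero n) (ev f n a) y) g.right.map_one).trans ?_
    rw [R.right.mul_comm _ (zero_add n), R.right.one_mul, mul_zero, Int.negOnePow_zero, one_smul]⟩

theorem right_mem_joinRing (n : ℤ) (b : B.right.X n) :
    ev g n b ∈ AddSubgroup.closure (joinGen f g n) :=
  AddSubgroup.subset_closure ⟨grPair (zero_add n) A.right.one b, by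
    refine (congrArg (fun y => R.right.mul (zero_add n) y (ev g n b)) f.right.map_one).trans ?_
    exact R.right.one_mul _⟩

/-- The subalgebra of `R` generated by the images of `A` and `B`. -/
def join : GrAlg k :=
  Under.mk (Y := joinRing f g)
    ⟨fun n => AddMonoidHom.mk' (fun a => ⟨R.hom.toFun n a, by
        rw [← ev_algebraMap f]; exact left_mem_joinRing f g n _⟩)
        (fun a b => Subtype.ext (map_add _ a b)),
      Subtype.ext R.hom.map_one, fun h a b => Subtype.ext (R.hom.map_mul h a b)⟩

/-- The join plays the role of the image of `A ⊗ B` in `R`. Since it is a subring of `R`, its map to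
`R` is mono, and its size is bounded by those of `A` and `B`. -/
theorem exists_join : ∃ (h : join f g ⟶ R) (f' : A ⟶ join f g) (g' : B ⟶ join f g),
    Mono h ∧ f' ≫ h = f ∧ g' ≫ h = g := by
  let h : join f g ⟶ R := homMk (A := join f g)
    (fun n => AddMonoidHom.mk' (fun x : (joinRing f g).X n => x.1) (fun _ _ => rfl))
    (fun _ _ _ => rfl) (fun _ _ => rfl)
  refine ⟨h, homMk (B := join f g)
      (fun n => AddMonoidHom.mk'
        (fun a => (⟨ev f n a, left_mem_joinRing f g n a⟩ : (joinRing f g).X n))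
        (fun a b => Subtype.ext (map_add _ a b)))
      (fun h a b => Subtype.ext (f.right.map_mul h a b))
      (fun n a => Subtype.ext (ev_algebraMap f n a)),
    homMk (B := join f g)
      (fun n => AddMonoidHom.mk'
        (fun a => (⟨ev g n a, right_mem_joinRing f g n a⟩ : (joinRing f g).X n))
        (fun a b => Subtype.ext (map_add _ a b)))
      (fun h a b => Subtype.ext (g.right.map_mul h a b))
      (fun n a => Subtype.ext (ev_algebraMap g n a)), ?_, rfl, rfl⟩
  exact mono_of_injective h fun n => Subtype.val_injective

end Generated

section Code

variable (k) (K : Type u)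

/-- The structure of an algebra transported to subsets of a set `K`, recorded by relations. -/
abbrev Code : Type u :=
  (ℤ → Set K) × (ℤ → K → K → K → Prop) × (ℤ → ℤ → ℤ → K → K → K → Prop) × (∀ n, k.X n → K → Prop)

variable {k K}

/-- The code of an algebra with injections to `K`. -/
def code (A : GrAlg k) (e : ∀ n, A.right.X n ↪ K) : Code k K :=
  (fun n => Set.range (e n),
    fun n x y z => ∃ a b, e n a = x ∧ e n b = y ∧ e n (a + b) = z,
    fun i j n x y z => ∃ (h : i + j = n) (a : A.right.X i) (b : A.right.X j),
      e i a = x ∧ e j b = y ∧ e n (A.right.mul h a b) = z,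
    fun n a x => e n (A.hom.toFun n a) = x)

/-- Equal codes have equal underlying subsets of `K`, so `e'⁻¹ ∘ e` makes sense and respects every
recorded operation. The unit is not recorded, as it is determined by the structure map from `k`. -/
theorem exists_hom_of_code_eq {A B : GrAlg k} {e : ∀ n, A.right.X n ↪ K}
    {e' : ∀ n, B.right.X n ↪ K} (h : code A e = code B e') :
    ∃ φ : A ⟶ B, ∀ n a, e' n (ev φ n a) = e n a := by
  simp only [code, Prod.mk.injEq] at h
  obtain ⟨h₁, h₂, h₃, h₄⟩ := h
  have ex : ∀ n a, ∃ b, e' n b = e n a := fun n a => by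
    have : e n a ∈ Set.range (e' n) := congrFun h₁ n ▸ Set.mem_range_self a
    exact this
  choose φ hφ using ex
  refine ⟨homMk (fun n => AddMonoidHom.mk' (φ n) fun a b => ?_) (fun {i j n} hn a b => ?_)
    (fun n a => ?_), hφ⟩
  · obtain ⟨a', b', ha, hb, hab⟩ := (iff_of_eq (congrFun (congrFun (congrFun (congrFun h₂ n)
      (e n a)) (e n b)) (e n (a + b)))).1 ⟨a, b, rfl, rfl, rfl⟩
    apply (e' n).injective
    rw [hφ, ← hab, (e' n).injective (ha.trans (hφ n a).symm),
      (e' n).injective (hb.trans (hφ n b).symm)]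
  · obtain ⟨_, a', b', ha, hb, hab⟩ := (iff_of_eq (congrFun (congrFun (congrFun (congrFun
      (congrFun (congrFun h₃ i) j) n) (e i a)) (e j b)) (e n (A.right.mul hn a b)))).1
      ⟨hn, a, b, rfl, rfl, rfl⟩
    apply (e' n).injective
    refine (hφ n _).trans (hab.symm.trans ?_)
    rw [(e' i).injective (ha.trans (hφ i a).symm), (e' j).injective (hb.trans (hφ j b).symm)]
    rfl
  · apply (e' n).injective
    refine (hφ n _).trans ?_
    exact ((iff_of_eq (congrFun (congrFun (congrFun h₄ n) a) _)).1 rfl).symm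

theorem nonempty_iso_of_code_eq {A B : GrAlg k} {e : ∀ n, A.right.X n ↪ K}
    {e' : ∀ n, B.right.X n ↪ K} (h : code A e = code B e') : Nonempty (A ≅ B) := by
  obtain ⟨φ, hφ⟩ := exists_hom_of_code_eq h
  obtain ⟨ψ, hψ⟩ := exists_hom_of_code_eq h.symm
  refine ⟨⟨φ, ψ, hom_ext fun n a => ?_, hom_ext fun n a => ?_⟩⟩
  · apply (e n).injective
    rw [ev_comp, hψ, hφ]
    rfl
  · apply (e' n).injective
    rw [ev_comp, hφ, hψ]
    rfl

end Code

-- Up to isomorphism, the algebras with at most `κ` elements in each degree form a small family, and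
-- this bound is stable under joins and pullbacks.
open Cardinal in
theorem exists_isSaturated {J : Type u} (B : J → GrAlg k) :
    ∃ (ι : Type u) (ob : ι → GrAlg k), IsSaturated ob ∧ ∀ j, ∃ i, Nonempty (ob i ≅ B j) := by
  -- The bound covers the given algebras and also `k` itself, which as initial algebra maps to every
  -- `R`.
  let κ : Cardinal.{u} := max ℵ₀ (#((Σ n : ULift.{u} ℤ, k.X n.down) ⊕ (Σ (j : J) (n : ULift.{u} ℤ), (B j).right.X n.down)))
  have hκ : ℵ₀ ≤ κ := le_max_left _ _
  have hB : ∀ j n, #((B j).right.X n) ≤ κ := fun j n => le_trans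
    (mk_le_of_injective (f := fun x => Sum.inr ⟨j, ⟨n⟩, x⟩) fun x y h => by simpa using h)
    (le_max_right _ _)
  have hk : ∀ n, #(k.X n) ≤ κ := fun n => le_trans
    (mk_le_of_injective (f := fun x => Sum.inl ⟨⟨n⟩, x⟩) fun x y h => by simpa using h)
    (le_max_right _ _)
  -- Algebras live in a larger universe but codes do not: one algebra is chosen for each code that
  -- occurs.
  let P : Code k κ.out → Prop := fun c => ∃ (A : GrAlg k) (e : ∀ n, A.right.X n ↪ κ.out), code A e = c
  choose ob e he using fun i : {c // P c} => i.2
  have small : ∀ i n, #((ob i).right.X n) ≤ κ := fun i n =>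
    (mk_le_of_injective (e i n).injective).trans (mk_out κ).le
  have key : ∀ A : GrAlg k, (∀ n, #(A.right.X n) ≤ κ) → ∃ i, Nonempty (ob i ≅ A) := by
    intro A hA
    have : ∀ n, Nonempty (A.right.X n ↪ κ.out) := fun n => by
      have := hA n
      rwa [← mk_out κ] at this
    let e' := fun n => (this n).some
    exact ⟨⟨code A e', A, e', rfl⟩, nonempty_iso_of_code_eq (he _)⟩
  refine ⟨{c // P c}, ob, ⟨fun R => ?_, fun {R i j} f g => ?_, fun {i j m} f g => ?_⟩,
    fun j => key (B j) (hB j)⟩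
  · obtain ⟨i, ⟨φ⟩⟩ := key (Under.mk (𝟙 k)) hk
    exact ⟨i, ⟨φ.hom ≫ Under.homMk R.hom (Category.id_comp _)⟩⟩
  · obtain ⟨m, ⟨φ⟩⟩ := key (join f g) (fun n => mk_addSubgroupClosure_le _ hκ
      (mk_range_le.trans (mk_grProd_le hκ (small i) (small j) n)))
    obtain ⟨h, f', g', hh, hf, hg⟩ := exists_join f g
    exact ⟨m, φ.hom ≫ h, f' ≫ φ.inv, g' ≫ φ.inv, mono_comp _ _, by simpa using hf,
      by simpa using hg⟩
  · obtain ⟨n, ⟨φ⟩⟩ := key (pullback f g) (fun n => by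
      refine (mk_le_of_injective Subtype.val_injective).trans ?_
      rw [GrCommRing.prod_X, mk_prod, lift_id, lift_id]
      exact mul_le_of_le hκ (small i n) (small j n))
    exact ⟨n, φ.hom ≫ pullbackFst f g, φ.hom ≫ pullbackSnd f g,
      IsPullback.of_iso (isPullback f g) φ.symm (Iso.refl _) (Iso.refl _) (Iso.refl _)
        (by simp) (by simp) (by simp) (by simp)⟩

end GrAlg

/-! ### Subfunctors generated under module operations and glueing. -/

section

namespace GrMod

variable {l : GrCommRing.{u}}

theorem hom_ext {M N : GrMod l} {f g : M ⟶ N}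
    (h : ∀ (n : ℤ) (a : M.X n), f.toFun n a = g.toFun n a) : f = g :=
  Hom.ext (funext fun n => AddMonoidHom.ext (h n))

/-- A graded submodule. -/
@[simps X]
def sub (M : GrMod l) (S : ∀ n, AddSubgroup (M.X n))
    (act_mem : ∀ {p i q : ℤ} (h : p + i = q) (x : M.X p) (a : l.X i), x ∈ S p →
      M.act h x a ∈ S q) : GrMod l where
  X n := S n
  act h := AddMonoidHom.mk' (fun x => AddMonoidHom.mk' (fun a => ⟨M.act h x.1 a, act_mem h _ _ x.2⟩)
      (fun a b => Subtype.ext (map_add (M.act h x.1) a b)))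
    (fun x y => AddMonoidHom.ext fun a => Subtype.ext
      (DFunLike.congr_fun (map_add (M.act h) x.1 y.1) a))
  act_one x := Subtype.ext (M.act_one x.1)
  act_act h₁ h₂ h₃ h₄ x a b := Subtype.ext (M.act_act h₁ h₂ h₃ h₄ x.1 a b)

/-- The product of a family of graded modules. -/
@[simps X]
def pi {J : Type u} (M : J → GrMod l) : GrMod l where
  X n := ∀ j, (M j).X n
  act h := AddMonoidHom.mk' (fun x => AddMonoidHom.mk' (fun a j => (M j).act h (x j) a)
      (fun a b => funext fun j => map_add ((M j).act h (x j)) a b))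
    (fun x y => AddMonoidHom.ext fun a => funext fun j =>
      DFunLike.congr_fun (map_add ((M j).act h) (x j) (y j)) a)
  act_one x := funext fun j => (M j).act_one (x j)
  act_act h₁ h₂ h₃ h₄ x a b := funext fun j => (M j).act_act h₁ h₂ h₃ h₄ (x j) a b

end GrMod

variable {k l : GrCommRing.{u}}

/-- The action of a functor to graded modules on morphisms, in degree `p`. -/
abbrev fmap (H : GrAlg k ⥤ GrMod l) {R R' : GrAlg k} (f : R ⟶ R') (p : ℤ) :
    (H.obj R).X p →+ (H.obj R').X p :=
  (H.map f).toFun p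

theorem fmap_comp (H : GrAlg k ⥤ GrMod l) {R R' R'' : GrAlg k} (f : R ⟶ R') (g : R' ⟶ R'')
    (p : ℤ) (x : (H.obj R).X p) : fmap H (f ≫ g) p x = fmap H g p (fmap H f p x) := by
  rw [fmap, H.map_comp]
  rfl

theorem fmap_id (H : GrAlg k ⥤ GrMod l) (R : GrAlg k) (p : ℤ) (x : (H.obj R).X p) :
    fmap H (𝟙 R) p x = x := by
  rw [fmap, H.map_id]
  rfl

theorem fmap_naturality {H H' : GrAlg k ⥤ GrMod l} (σ : H ⟶ H') {R R' : GrAlg k} (f : R ⟶ R')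
    (p : ℤ) (x : (H.obj R).X p) :
    (σ.app R').toFun p (fmap H f p x) = fmap H' f p ((σ.app R).toFun p x) :=
  DFunLike.congr_fun (congrFun (congrArg GrMod.Hom.toFun (σ.naturality f)) p) x

theorem app_naturality {X : GrAlg k ⥤ GradedObject ℤ (Type u)} {H : GrAlg k ⥤ GrMod l}
    (φ : X ⟶ und H) {R R' : GrAlg k} (f : R ⟶ R') (p : ℤ) (x : X.obj R p) :
    φ.app R' p (X.map f p x) = fmap H f p (φ.app R p x) :=
  ConcreteCategory.congr_hom (congrFun (φ.naturality f) p) x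

theorem fmod_hom_ext {H H' : GrAlg k ⥤ GrMod l} {σ τ : H ⟶ H'}
    (h : ∀ (R : GrAlg k) (p : ℤ) (x : (H.obj R).X p),
      (σ.app R).toFun p x = (τ.app R).toFun p x) : σ = τ :=
  NatTrans.ext (funext fun R => GrMod.hom_ext (h R))

theorem und_hom_ext {X Y : GrAlg k ⥤ GradedObject ℤ (Type u)} {φ ψ : X ⟶ Y}
    (h : ∀ (R : GrAlg k) (p : ℤ) (x : X.obj R p), φ.app R p x = ψ.app R p x) : φ = ψ :=
  NatTrans.ext (funext fun R => funext fun p => ConcreteCategory.hom_ext _ _ (h R p))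

/-- A functor to graded modules is left exact if it is so on underlying sets in each degree. -/
def IsGrLex (H : GrAlg k ⥤ GrMod l) : Prop :=
  ∀ p : ℤ, IsLex (und H ⋙ GradedObject.eval p)

namespace IsGrLex

variable {H : GrAlg k ⥤ GrMod l}

theorem injective (hH : IsGrLex H) {R R' : GrAlg k} (f : R ⟶ R') [Mono f] (p : ℤ) :
    Function.Injective (fmap H f p) :=
  (hH p).injective f

theorem exists_glue (hH : IsGrLex H) {A B B' D : GrAlg k} {a : A ⟶ B} {a' : A ⟶ B'} {f : B ⟶ D} {f' : B' ⟶ D}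
    (sq : IsPullback a a' f f') {p : ℤ} (x : (H.obj B).X p) (x' : (H.obj B').X p)
    (h : fmap H f p x = fmap H f' p x') :
    ∃ z : (H.obj A).X p, fmap H a p z = x ∧ fmap H a' p z = x' :=
  (hH p).exists_glue sq x x' h

theorem hom_ext (hH : IsGrLex H) {A B B' D : GrAlg k} {a : A ⟶ B} {a' : A ⟶ B'} {f : B ⟶ D} {f' : B' ⟶ D}
    (sq : IsPullback a a' f f') {p : ℤ} (z z' : (H.obj A).X p)
    (h : fmap H a p z = fmap H a p z') (h' : fmap H a' p z = fmap H a' p z') : z = z' :=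
  (hH p).hom_ext sq z z' h h'

end IsGrLex

/-- The product of a family of functors to graded modules. -/
def piFunctor {J : Type u} (H : J → GrAlg k ⥤ GrMod l) : GrAlg k ⥤ GrMod l where
  obj R := GrMod.pi fun j => (H j).obj R
  map f := ⟨fun p => AddMonoidHom.mk' (fun x j => fmap (H j) f p (x j))
      (fun x y => funext fun j => map_add (fmap (H j) f p) (x j) (y j)),
    fun h x a => funext fun j => ((H j).map f).map_act h (x j) a⟩
  map_id R := GrMod.hom_ext fun p x => funext fun j => fmap_id (H j) R p (x j)
  map_comp f g := GrMod.hom_ext fun p x => funext fun j => fmap_comp (H j) f g p (x j)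

/-- The projections of a product of functors to graded modules. -/
def piProj {J : Type u} (H : J → GrAlg k ⥤ GrMod l) (j : J) : piFunctor H ⟶ H j where
  app R := ⟨fun p => AddMonoidHom.mk' (fun x : ((piFunctor H).obj R).X p => x j)
    (fun _ _ => rfl), fun _ _ _ => rfl⟩

/-- The map to a product with given components. -/
def piLift {J : Type u} {H : J → GrAlg k ⥤ GrMod l} {X : GrAlg k ⥤ GradedObject ℤ (Type u)}
    (φ : ∀ j, X ⟶ und (H j)) : X ⟶ und (piFunctor H) where
  app R := fun p => ↾(fun x j => (φ j).app R p x)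
  naturality R R' f := by
    funext p
    ext x
    exact funext fun j => app_naturality (φ j) f p x

theorem isGrLex_piFunctor {J : Type u} {H : J → GrAlg k ⥤ GrMod l} (hH : ∀ j, IsGrLex (H j)) :
    IsGrLex (piFunctor H) := by
  refine fun p => ⟨fun {R} hR => ?_, fun {A B B' D a a' f f'} sq x x' h => ?_,
    fun {A B B' D a a' f f'} sq z z' h h' => ?_⟩
  · refine ⟨(0 : ((piFunctor H).obj R).X p), fun y => funext fun j => ?_⟩
    obtain ⟨x, hx⟩ := (hH j p).terminal hR
    exact (hx (y j)).trans (hx (0 : ((H j).obj R).X p)).symm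
  · choose z hz hz' using fun j => (hH j).exists_glue sq (x j) (x' j) (congrFun h j)
    exact ⟨z, funext hz, funext hz'⟩
  · exact funext fun j => (hH j).hom_ext sq (z j) (z' j) (congrFun h j) (congrFun h' j)

section Closure

variable {ι : Type u} {ob : ι → GrAlg k} {X : GrAlg k ⥤ GradedObject ℤ (Type u)}
  {H : GrAlg k ⥤ GrMod l}

/-- The elements over the members of a family of algebras that are obtained from the values of `φ`
by module operations, functoriality, and glueing along pullback squares. -/
inductive Gen (ob : ι → GrAlg k) (φ : X ⟶ und H) :
    ∀ (i : ι) (p : ℤ), (H.obj (ob i)).X p → Prop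
  | of {i p} (x : X.obj (ob i) p) : Gen ob φ i p (φ.app (ob i) p x)
  | zero {i p} : Gen ob φ i p 0
  | add {i p x y} : Gen ob φ i p x → Gen ob φ i p y → Gen ob φ i p (x + y)
  | neg {i p x} : Gen ob φ i p x → Gen ob φ i p (-x)
  | act {i p q r x} (h : p + q = r) (a : l.X q) : Gen ob φ i p x →
      Gen ob φ i r ((H.obj (ob i)).act h x a)
  | map {i j p x} (f : ob i ⟶ ob j) : Gen ob φ i p x → Gen ob φ j p (fmap H f p x)
  | glue {i j j' m p x} {a : ob i ⟶ ob j} {a' : ob i ⟶ ob j'} {f : ob j ⟶ ob m}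
      {f' : ob j' ⟶ ob m} (sq : IsPullback a a' f f') : Gen ob φ j p (fmap H a p x) →
      Gen ob φ j' p (fmap H a' p x) → Gen ob φ i p x

variable (hob : IsSaturated ob) (φ : X ⟶ und H)

/-- The elements of `H` that come from a generated element over a member of the family. -/
def closureSet (R : GrAlg k) (p : ℤ) : AddSubgroup ((H.obj R).X p) where
  carrier := {y | ∃ (i : ι) (f : ob i ⟶ R) (x : (H.obj (ob i)).X p),
    Gen ob φ i p x ∧ fmap H f p x = y}
  zero_mem' := by
    obtain ⟨i, ⟨f⟩⟩ := hob.exists_hom R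
    exact ⟨i, f, 0, .zero, map_zero _⟩
  add_mem' := by
    rintro _ _ ⟨i, f, x, hx, rfl⟩ ⟨j, g, y, hy, rfl⟩
    obtain ⟨m, h, f', g', -, rfl, rfl⟩ := hob.exists_mono f g
    exact ⟨m, h, _, .add (.map f' hx) (.map g' hy), by rw [map_add, fmap_comp, fmap_comp]⟩
  neg_mem' := by
    rintro _ ⟨i, f, x, hx, rfl⟩
    exact ⟨i, f, _, .neg hx, map_neg _ _⟩

theorem Gen.mem_closureSet {i : ι} {p : ℤ} {x : (H.obj (ob i)).X p} (hx : Gen ob φ i p x) :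
    x ∈ closureSet hob φ (ob i) p :=
  ⟨i, 𝟙 _, x, hx, fmap_id H _ p x⟩

theorem map_mem_closureSet {R R' : GrAlg k} (f : R ⟶ R') {p : ℤ} {x : (H.obj R).X p}
    (hx : x ∈ closureSet hob φ R p) : fmap H f p x ∈ closureSet hob φ R' p := by
  obtain ⟨i, g, x, hx, rfl⟩ := hx
  exact ⟨i, g ≫ f, x, hx, fmap_comp H g f p x⟩

/-- The subfunctor of `H` generated by `φ`. -/
def genClosure : GrAlg k ⥤ GrMod l where
  obj R := (H.obj R).sub (closureSet hob φ R) (by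
    rintro p q r h _ a ⟨i, f, x, hx, rfl⟩
    exact ⟨i, f, _, .act h a hx, (H.map f).map_act h x a⟩)
  map f := ⟨fun p => AddMonoidHom.mk' (fun x => ⟨fmap H f p x.1, map_mem_closureSet hob φ f x.2⟩)
      (fun x y => Subtype.ext (map_add (fmap H f p) x.1 y.1)),
    fun h x a => Subtype.ext ((H.map f).map_act h x.1 a)⟩
  map_id R := GrMod.hom_ext fun p x => Subtype.ext (fmap_id H R p x.1)
  map_comp f g := GrMod.hom_ext fun p x => Subtype.ext (fmap_comp H f g p x.1)

/-- The inclusion of the subfunctor generated by `φ`. -/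
def closureIncl : genClosure hob φ ⟶ H where
  app R := ⟨fun p => AddMonoidHom.mk' (fun x : ((genClosure hob φ).obj R).X p => x.1)
    (fun _ _ => rfl), fun _ _ _ => rfl⟩

theorem app_mem_closureSet (hX : ∀ p, IsGeneratedBy ob (X ⋙ GradedObject.eval p))
    (R : GrAlg k) (p : ℤ) (x : X.obj R p) : φ.app R p x ∈ closureSet hob φ R p := by
  obtain ⟨i, f, x, rfl⟩ := hX p R x
  exact ⟨i, f, _, .of x, (app_naturality φ f p x).symm⟩

/-- The factorization of `φ` through the subfunctor generated by it. -/
def closureLift (hX : ∀ p, IsGeneratedBy ob (X ⋙ GradedObject.eval p)) :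
    X ⟶ und (genClosure hob φ) where
  app R := fun p => ↾(fun x => ⟨φ.app R p x, app_mem_closureSet hob φ hX R p x⟩)
  naturality R R' f := by
    funext p
    ext x
    exact Subtype.ext (app_naturality φ f p x)

theorem isGeneratedBy_genClosure (p : ℤ) :
    IsGeneratedBy ob (und (genClosure hob φ) ⋙ GradedObject.eval p) := by
  rintro R ⟨_, i, f, x, hx, rfl⟩
  exact ⟨i, f, ⟨x, hx.mem_closureSet hob φ⟩, rfl⟩

/-- Only the existence of glued elements needs an argument: `H` provides the element, and it must be
shown to come from a generated one over a member of the family. -/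
theorem isGrLex_genClosure (hH : IsGrLex H) : IsGrLex (genClosure hob φ) := by
  refine fun p => ⟨fun {R} hR => ?_, fun {A B B' D a a' f f'} sq x x' h => ?_,
    fun {A B B' D a a' f f'} sq z z' h h' => ?_⟩
  -- The only element of `H` over a terminal algebra is `0`, which lies in every subgroup.
  · refine ⟨(0 : ((genClosure hob φ).obj R).X p), fun y => Subtype.ext ?_⟩
    obtain ⟨x, hx⟩ := (hH p).terminal hR
    exact (hx y.1).trans (hx (0 : (H.obj R).X p)).symm
  · obtain ⟨_, i, g, x, hx, rfl⟩ := x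
    obtain ⟨_, j, g', x', hx', rfl⟩ := x'
    have h : fmap H f p (fmap H g p x) = fmap H f' p (fmap H g' p x') := congrArg Subtype.val h
    -- The equation in `D` already holds over the subobject `ob m`, so the generated elements `x`,
    -- `x'` glue over a pullback `ob n` taken inside the family. The result is generated by
    -- `Gen.glue` and is then transported to `A`.
    obtain ⟨m, c, b, b', _, hb, hb'⟩ := hob.exists_mono (g ≫ f) (g' ≫ f')
    obtain ⟨n, q, q', sq'⟩ := hob.exists_isPullback b b'
    obtain ⟨z, rfl, rfl⟩ := hH.exists_glue sq' x x' (by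
      apply hH.injective c
      rw [← fmap_comp, ← fmap_comp, hb, hb', fmap_comp, fmap_comp, h])
    have w : (q ≫ g) ≫ f = (q' ≫ g') ≫ f' := by
      rw [Category.assoc, Category.assoc, ← hb, ← hb', reassoc_of% sq'.w]
    refine ⟨⟨fmap H (sq.lift _ _ w) p z, n, _, z, .glue sq' hx hx', rfl⟩,
      Subtype.ext ?_, Subtype.ext ?_⟩
    · refine (fmap_comp H _ _ p z).symm.trans ?_
      rw [sq.lift_fst, fmap_comp]
    · refine (fmap_comp H _ _ p z).symm.trans ?_
      rw [sq.lift_snd, fmap_comp]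
  · exact Subtype.ext (hH.hom_ext sq z.1 z'.1 (congrArg Subtype.val h) (congrArg Subtype.val h'))

/-- Induction on the generation of an element. The glueing case is where left exactness of the
target enters: two elements with equal images at both corners coincide. -/
theorem genClosure_hom_ext (hX : ∀ p, IsGeneratedBy ob (X ⋙ GradedObject.eval p))
    {G : GrAlg k ⥤ GrMod l} (hG : IsGrLex G) {α β : genClosure hob φ ⟶ G}
    (h : closureLift hob φ hX ≫ undMap α = closureLift hob φ hX ≫ undMap β) : α = β := by
  have key : ∀ {i p} {x : (H.obj (ob i)).X p} (hx : Gen ob φ i p x),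
      (α.app (ob i)).toFun p ⟨x, hx.mem_closureSet hob φ⟩ =
        (β.app (ob i)).toFun p ⟨x, hx.mem_closureSet hob φ⟩ := by
    intro i p x hx
    induction hx with
    | @of i p x =>
      exact ConcreteCategory.congr_hom (congrFun (congrArg (fun τ => NatTrans.app τ (ob i)) h) p) x
    | zero => exact (map_zero _).trans (map_zero _).symm
    | @add i p x y hx hy ihx ihy =>
      refine (map_add ((α.app (ob i)).toFun p) ⟨x, hx.mem_closureSet hob φ⟩
        ⟨y, hy.mem_closureSet hob φ⟩).trans (Eq.trans ?_
        (map_add ((β.app (ob i)).toFun p) ⟨x, hx.mem_closureSet hob φ⟩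
        ⟨y, hy.mem_closureSet hob φ⟩).symm)
      rw [ihx, ihy]
    | @neg i p x hx ih =>
      refine (map_neg ((α.app (ob i)).toFun p) ⟨x, hx.mem_closureSet hob φ⟩).trans (Eq.trans ?_
        (map_neg ((β.app (ob i)).toFun p) ⟨x, hx.mem_closureSet hob φ⟩).symm)
      rw [ih]
    | @act i p q r x h a hx ih =>
      refine ((α.app (ob i)).map_act h ⟨x, hx.mem_closureSet hob φ⟩ a).trans (Eq.trans ?_
        ((β.app (ob i)).map_act h ⟨x, hx.mem_closureSet hob φ⟩ a).symm)
      rw [ih]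
    | @map i j p x f hx ih =>
      refine (fmap_naturality α f p ⟨x, hx.mem_closureSet hob φ⟩).trans (Eq.trans ?_
        (fmap_naturality β f p ⟨x, hx.mem_closureSet hob φ⟩).symm)
      rw [ih]
    | @glue i j j' m p x a a' f f' sq hx hx' ih ih' =>
      have hm := (Gen.glue sq hx hx').mem_closureSet hob φ
      exact hG.hom_ext sq _ _
        ((fmap_naturality α a p ⟨x, hm⟩).symm.trans (ih.trans (fmap_naturality β a p ⟨x, hm⟩)))
        ((fmap_naturality α a' p ⟨x, hm⟩).symm.trans (ih'.trans (fmap_naturality β a' p ⟨x, hm⟩)))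
  refine fmod_hom_ext fun R p => ?_
  rintro ⟨_, i, f, x, hx, rfl⟩
  refine (fmap_naturality α f p ⟨x, hx.mem_closureSet hob φ⟩).trans (Eq.trans ?_
    (fmap_naturality β f p ⟨x, hx.mem_closureSet hob φ⟩).symm)
  rw [key hx]

end Closure

end

/-! ### Formal expressions and the universal natural transformation. -/

section

variable {k l : GrCommRing.{u}} {ι : Type u} {ob : ι → GrAlg k}
  {X : GrAlg k ⥤ GradedObject ℤ (Type u)}

/-- Formal expressions for the elements of the subfunctor generated by a natural transformation
from `X` to a functor to graded `l`-modules. -/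
inductive GenTerm (l : GrCommRing.{u}) (ob : ι → GrAlg k)
    (X : GrAlg k ⥤ GradedObject ℤ (Type u)) : ι → ℤ → Type u
  | of {i p} (x : X.obj (ob i) p) : GenTerm l ob X i p
  | zero {i p} : GenTerm l ob X i p
  | add {i p} : GenTerm l ob X i p → GenTerm l ob X i p → GenTerm l ob X i p
  | neg {i p} : GenTerm l ob X i p → GenTerm l ob X i p
  | act {i p q r} (h : p + q = r) (a : l.X q) : GenTerm l ob X i p → GenTerm l ob X i r
  | map {i j p} (f : ob i ⟶ ob j) : GenTerm l ob X i p → GenTerm l ob X j p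
  | glue {i j j' m p} (a : ob i ⟶ ob j) (a' : ob i ⟶ ob j') (f : ob j ⟶ ob m)
      (f' : ob j' ⟶ ob m) (sq : IsPullback a a' f f') : GenTerm l ob X j p →
      GenTerm l ob X j' p → GenTerm l ob X i p

namespace GenTerm

variable {H H' : GrAlg k ⥤ GrMod l}

open Classical in
/-- The value of an expression; expressions which cannot be glued have the value `0`. -/
noncomputable def eval (φ : X ⟶ und H) :
    ∀ {i : ι} {p : ℤ}, GenTerm l ob X i p → (H.obj (ob i)).X p
  | i, p, of x => φ.app (ob i) p x
  | _, _, zero => 0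
  | _, _, add s t => eval φ s + eval φ t
  | _, _, neg s => - eval φ s
  | i, _, act h a s => (H.obj (ob i)).act h (eval φ s) a
  | _, p, map f s => fmap H f p (eval φ s)
  | i, p, glue a a' _ _ _ s t =>
      if h : ∃ z : (H.obj (ob i)).X p, fmap H a p z = eval φ s ∧ fmap H a' p z = eval φ t
        then h.choose else 0

/-- For a glued expression `eval` makes a choice; uniqueness of glueing in `H` shows that the choice
is the given element. -/
theorem exists_eval_eq (hH : IsGrLex H) (φ : X ⟶ und H) {i : ι} {p : ℤ} {x : (H.obj (ob i)).X p}
    (hx : Gen ob φ i p x) : ∃ t : GenTerm l ob X i p, eval φ t = x := by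
  induction hx with
  | of x => exact ⟨of x, rfl⟩
  | zero => exact ⟨zero, rfl⟩
  | add _ _ hs ht =>
    obtain ⟨s, rfl⟩ := hs
    obtain ⟨t, rfl⟩ := ht
    exact ⟨add s t, rfl⟩
  | neg _ hs =>
    obtain ⟨s, rfl⟩ := hs
    exact ⟨neg s, rfl⟩
  | act h a _ hs =>
    obtain ⟨s, rfl⟩ := hs
    exact ⟨act h a s, rfl⟩
  | map f _ hs =>
    obtain ⟨s, rfl⟩ := hs
    exact ⟨map f s, rfl⟩
  | @glue i j j' m p x a a' f f' sq _ _ hs ht =>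
    obtain ⟨s, hs⟩ := hs
    obtain ⟨t, ht⟩ := ht
    refine ⟨glue a a' f f' sq s t, ?_⟩
    have h : ∃ z : (H.obj (ob i)).X p, fmap H a p z = eval φ s ∧ fmap H a' p z = eval φ t :=
      ⟨x, hs.symm, ht.symm⟩
    rw [eval, dif_pos h]
    exact hH.hom_ext sq _ _ (h.choose_spec.1.trans hs) (h.choose_spec.2.trans ht)

/-- The relation on expressions to have equal values. -/
def rel (ob : ι → GrAlg k) (φ : X ⟶ und H) (i : ι) (p : ℤ) (s t : GenTerm l ob X i p) : Prop :=
  eval φ s = eval φ t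

/-- If equality of values under `φ` is the same as under `φ'`, then the subfunctor generated by `φ`
maps to the target of `φ'`. -/
theorem exists_hom_of_rel_eq (hob : IsSaturated ob)
    (hX : ∀ p, IsGeneratedBy ob (X ⋙ GradedObject.eval p)) (hH : IsGrLex H)
    (φ : X ⟶ und H) (φ' : X ⟶ und H') (h : rel ob φ = rel ob φ') :
    ∃ σ : genClosure hob φ ⟶ H', closureLift hob φ hX ≫ undMap σ = φ' := by
  -- The graph of the desired map: the two values of one expression, pushed forward to `R`.
  let P : ∀ (R : GrAlg k) (p : ℤ), (H.obj R).X p → (H'.obj R).X p → Prop := fun R p y y' =>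
    ∃ (i : ι) (f : ob i ⟶ R) (t : GenTerm l ob X i p),
      fmap H f p (eval φ t) = y ∧ fmap H' f p (eval φ' t) = y'
  have ex : ∀ (R : GrAlg k) (p : ℤ) (y : ((genClosure hob φ).obj R).X p), ∃ y', P R p y.1 y' := by
    rintro R p ⟨_, i, f, x, hx, rfl⟩
    obtain ⟨t, rfl⟩ := exists_eval_eq hH φ hx
    exact ⟨_, i, f, t, rfl, rfl⟩
  have uniq : ∀ {R : GrAlg k} {p : ℤ} {y : (H.obj R).X p} {z z' : (H'.obj R).X p},
      P R p y z → P R p y z' → z = z' := by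
    rintro R p y z z' ⟨i, f, t, rfl, rfl⟩ ⟨j, g, s, hs, rfl⟩
    obtain ⟨m, c, f', g', _, rfl, rfl⟩ := hob.exists_mono f g
    rw [fmap_comp, fmap_comp] at hs ⊢
    -- Over the subobject `ob m` the values under `φ` agree before being mapped to `R`, so the
    -- hypothesis on relations transfers the equality to `φ'`.
    have e : rel ob φ m p (map g' s) (map f' t) := hH.injective c p hs
    rw [h] at e
    exact congrArg (fmap H' c p) e.symm
  choose F hF using ex
  have add : ∀ {R : GrAlg k} {p : ℤ} {y₁ y₂ : (H.obj R).X p} {z₁ z₂ : (H'.obj R).X p},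
      P R p y₁ z₁ → P R p y₂ z₂ → P R p (y₁ + y₂) (z₁ + z₂) := by
    rintro R p _ _ _ _ ⟨i, f, t, rfl, rfl⟩ ⟨j, g, s, rfl, rfl⟩
    obtain ⟨m, c, f', g', _, rfl, rfl⟩ := hob.exists_mono f g
    refine ⟨m, c, .add (map f' t) (map g' s), ?_, ?_⟩
    · exact (map_add _ _ _).trans (congrArg₂ _ (fmap_comp H f' c p _).symm
        (fmap_comp H g' c p _).symm)
    · exact (map_add _ _ _).trans (congrArg₂ _ (fmap_comp H' f' c p _).symm
        (fmap_comp H' g' c p _).symm)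
  refine ⟨{ app := fun R => ⟨fun p => AddMonoidHom.mk' (F R p)
              (fun y y' => uniq (hF R p (y + y')) (add (hF R p y) (hF R p y'))),
              fun {p i q} hq y a => uniq (hF R q _) ?_⟩
            naturality := fun R R' f => GrMod.hom_ext fun p y => uniq (hF R' p _) ?_ }, ?_⟩
  · obtain ⟨i, f, t, ht, ht'⟩ := hF R p y
    refine ⟨i, f, .act hq a t, ?_, ?_⟩
    · exact ((H.map f).map_act hq _ a).trans (congrArg (fun z => (H.obj R).act hq z a) ht)
    · exact ((H'.map f).map_act hq _ a).trans (congrArg (fun z => (H'.obj R).act hq z a) ht')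
  · obtain ⟨i, g, t, ht, ht'⟩ := hF R p y
    refine ⟨i, g ≫ f, t, ?_, ?_⟩
    · exact (fmap_comp H g f p _).trans (congrArg (fmap H f p) ht)
    · exact (fmap_comp H' g f p _).trans (congrArg (fmap H' f p) ht')
  · refine und_hom_ext fun R p x => ?_
    obtain ⟨i, f, x, rfl⟩ := hX p R x
    refine uniq (hF R p _) ⟨i, f, .of x, ?_, ?_⟩
    · exact (app_naturality φ f p x).symm
    · exact (app_naturality φ' f p x).symm

end GenTerm

theorem IsGrLex.of_isIndRep {H : GrAlg k ⥤ GrMod l} (h : IsIndRep (und H)) : IsGrLex H :=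
  fun p => (isLex_and_exists_isGeneratedBy (h p)).1

/-- A property of natural transformations from `X` to functors to graded modules that holds as soon
as it holds after composition with a jointly injective family. -/
def IsDetectedByInjective (Φ : ∀ H : GrAlg k ⥤ GrMod l, (X ⟶ und H) → Prop) : Prop :=
  ∀ {J : Type u} {H : GrAlg k ⥤ GrMod l} {K : J → GrAlg k ⥤ GrMod l} (σ : ∀ j, H ⟶ K j)
    (φ : X ⟶ und H),
    (∀ (R : GrAlg k) (p : ℤ) (x y : (H.obj R).X p),
      (∀ j, ((σ j).app R).toFun p x = ((σ j).app R).toFun p y) → x = y) →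
    (∀ j, Φ (K j) (φ ≫ undMap (σ j))) → Φ H φ

/-- Among the natural transformations from a small functor `X` to formal module schemes with
a property detected by injective families, there is a universal one. -/
theorem exists_universal (hob : IsSaturated ob)
    (hX : ∀ p, IsGeneratedBy ob (X ⋙ GradedObject.eval p))
    {Φ : ∀ H : GrAlg k ⥤ GrMod l, (X ⟶ und H) → Prop} (hΦ : IsDetectedByInjective Φ) :
    ∃ (T : FModSch k l) (υ : X ⟶ und T.obj), Φ T.obj υ ∧
      ∀ (H : FModSch k l) (φ : X ⟶ und H.obj), Φ H.obj φ →
        ∃! f : T ⟶ H, υ ≫ undMap f.hom = φ := by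
  -- The quantifier over all `H` would leave the universe; indexing by the relations that occur
  -- keeps `J` small.
  let J : Type u := {r : ∀ (i : ι) (p : ℤ), GenTerm l ob X i p → GenTerm l ob X i p → Prop //
    ∃ (H : GrAlg k ⥤ GrMod l) (φ : X ⟶ und H), IsGrLex H ∧ Φ H φ ∧ GenTerm.rel ob φ = r}
  choose K ψ hK hψ hr using fun j : J => j.2
  -- The factors are the generated subfunctors and not the whole `K j`, because the comparison maps
  -- to other targets are defined only there.
  let ψ' : X ⟶ und (piFunctor fun j => genClosure hob (ψ j)) :=
    piLift fun j => closureLift hob (ψ j) hX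
  have hlex : IsGrLex (genClosure hob ψ') :=
    isGrLex_genClosure hob ψ' (isGrLex_piFunctor fun j => isGrLex_genClosure hob (ψ j) (hK j))
  let T : FModSch k l := ⟨genClosure hob ψ', fun p =>
    isIndObject_of_isLex (hlex p) (isGeneratedBy_genClosure hob ψ' p)⟩
  let σ : ∀ j, T.obj ⟶ genClosure hob (ψ j) := fun j => closureIncl hob ψ' ≫ piProj _ j
  -- The maps `T ⟶ K j` are jointly injective and restrict to the `ψ j` on `X`, which have the
  -- property by choice.
  refine ⟨T, closureLift hob ψ' hX,
    hΦ (fun j => σ j ≫ closureIncl hob (ψ j)) _ (fun R p x y h => ?_) hψ, fun H φ hφ => ?_⟩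
  · exact Subtype.ext (funext fun j => Subtype.ext (h j))
  · have hH := IsGrLex.of_isIndRep H.property
    -- The index is the relation of `φ` itself; the `ψ j` chosen for it may have another target but
    -- induces the same relation.
    obtain ⟨τ, hτ⟩ := GenTerm.exists_hom_of_rel_eq hob hX (hK ⟨_, H.obj, φ, hH, hφ, rfl⟩) _ φ (hr _)
    refine ⟨ObjectProperty.homMk (σ _ ≫ τ), hτ, fun f hf => ?_⟩
    apply ObjectProperty.hom_ext
    exact genClosure_hom_ext hob ψ' hX hH (hf.trans hτ.symm)

end

/-! ### Bilinear maps and the objectwise tensor product. -/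

section Bilinear

variable {k l : GrCommRing.{u}}

variable {F G : GrAlg k ⥤ GrMod l}

theorem objProd_hom_ext {X : GrAlg k ⥤ GradedObject ℤ (Type u)}
    {φ ψ : objProd (und F) (und G) ⟶ X}
    (h : ∀ (R : GrAlg k) {p q n : ℤ} (hn : p + q = n) (x : (F.obj R).X p) (y : (G.obj R).X q),
      φ.app R n (grPair hn x y) = ψ.app R n (grPair hn x y)) : φ = ψ :=
  und_hom_ext fun R _ z => h R z.1.2 z.2.1 z.2.2

theorem IsBilinear.comp {H K : GrAlg k ⥤ GrMod l} {φ : objProd (und F) (und G) ⟶ und H}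
    (hφ : IsBilinear φ) (σ : H ⟶ K) : IsBilinear (φ ≫ undMap σ) := fun R =>
  { add_left := fun h x x' y =>
      (congrArg ((σ.app R).toFun _) ((hφ R).add_left h x x' y)).trans (map_add _ _ _)
    add_right := fun h x y y' =>
      (congrArg ((σ.app R).toFun _) ((hφ R).add_right h x y y')).trans (map_add _ _ _)
    act_right := fun h h₁ h₂ h₃ x y a =>
      (congrArg ((σ.app R).toFun _) ((hφ R).act_right h h₁ h₂ h₃ x y a)).trans
        ((σ.app R).map_act h₃ _ a)
    act_left := fun {p q i n p' m} h h₁ h₂ h₃ x y a => by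
      refine (congrArg ((σ.app R).toFun _) ((hφ R).act_left h h₁ h₂ h₃ x y a)).trans ?_
      rw [Units.smul_def, Units.smul_def, map_zsmul]
      exact congrArg (_ • ·) ((σ.app R).map_act h₃ _ a) }

/-- Bilinearity consists of equations between module expressions, so it can be tested after jointly
injective linear maps. This is the condition required by `exists_universal`. -/
theorem IsBilinear.of_injective {J : Type u} {H : GrAlg k ⥤ GrMod l} {K : J → GrAlg k ⥤ GrMod l}
    (σ : ∀ j, H ⟶ K j) (φ : objProd (und F) (und G) ⟶ und H)
    (hσ : ∀ (R : GrAlg k) (p : ℤ) (x y : (H.obj R).X p),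
      (∀ j, ((σ j).app R).toFun p x = ((σ j).app R).toFun p y) → x = y)
    (h : ∀ j, IsBilinear (φ ≫ undMap (σ j))) : IsBilinear φ := fun R =>
  { add_left := fun hn x x' y => hσ R _ _ _ fun j =>
      ((h j R).add_left hn x x' y).trans (map_add ((σ j).app R |>.toFun _) _ _).symm
    add_right := fun hn x y y' => hσ R _ _ _ fun j =>
      ((h j R).add_right hn x y y').trans (map_add ((σ j).app R |>.toFun _) _ _).symm
    act_right := fun hn h₁ h₂ h₃ x y a => hσ R _ _ _ fun j =>
      ((h j R).act_right hn h₁ h₂ h₃ x y a).trans (((σ j).app R).map_act h₃ _ a).symm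
    act_left := fun {p q i n p' m} hn h₁ h₂ h₃ x y a => hσ R _ _ _ fun j => by
      refine ((h j R).act_left hn h₁ h₂ h₃ x y a).trans ?_
      rw [Units.smul_def, Units.smul_def, map_zsmul]
      exact congrArg (_ • ·) (((σ j).app R).map_act h₃ _ a).symm }

theorem IsBilinear.precomp {F' G' H : GrAlg k ⥤ GrMod l} {φ : objProd (und F') (und G') ⟶ und H}
    (hφ : IsBilinear φ) (σ : F ⟶ F') (τ : G ⟶ G') :
    IsBilinear (objProdMap (undMap σ) (undMap τ) ≫ φ) := fun R =>
  { add_left := fun h x x' y => by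
      refine Eq.trans ?_ ((hφ R).add_left h ((σ.app R).toFun _ x) ((σ.app R).toFun _ x')
        ((τ.app R).toFun _ y))
      rw [← map_add]
      rfl
    add_right := fun h x y y' => by
      refine Eq.trans ?_ ((hφ R).add_right h ((σ.app R).toFun _ x) ((τ.app R).toFun _ y)
        ((τ.app R).toFun _ y'))
      rw [← map_add]
      rfl
    act_right := fun h h₁ h₂ h₃ x y a => by
      refine Eq.trans ?_ ((hφ R).act_right h h₁ h₂ h₃ ((σ.app R).toFun _ x)
        ((τ.app R).toFun _ y) a)
      rw [← (τ.app R).map_act]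
      rfl
    act_left := fun h h₁ h₂ h₃ x y a => by
      refine Eq.trans ?_ ((hφ R).act_left h h₁ h₂ h₃ ((σ.app R).toFun _ x)
        ((τ.app R).toFun _ y) a)
      rw [← (σ.app R).map_act]
      rfl }

theorem isBilinear_objTmul (F G : GrAlg k ⥤ GrMod l) : IsBilinear (objTmul F G) := fun R =>
  { add_left := fun h x x' y => GrMod.tmul_add_left _ _ h x x' y
    add_right := fun h x y y' => GrMod.tmul_add_right _ _ h x y y'
    act_right := fun h h₁ h₂ h₃ x y a =>
      (GrMod.tensorAct_tmul (F.obj R) (G.obj R) h₃ a h h₁ h₂ x y).symm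
    act_left := fun {p q i n p' m} h h₁ h₂ h₃ x y a => by
      refine (GrMod.tmul_balanced (F.obj R) (G.obj R) h₁ h₂ rfl (by omega) x y a).trans ?_
      exact congrArg (_ • ·) (GrMod.tensorAct_tmul (F.obj R) (G.obj R) h₃ a h rfl _ x y).symm }

theorem objTensor_hom_ext {H : GrAlg k ⥤ GrMod l} {s t : objTensor F G ⟶ H}
    (h : objTmul F G ≫ undMap s = objTmul F G ≫ undMap t) : s = t := by
  refine NatTrans.ext (funext fun R => GrMod.Hom.ext (funext fun n => ?_))
  refine GrMod.tensor_hom_ext fun {p q} hn x y => ?_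
  exact ConcreteCategory.congr_hom (congrFun (congrArg (fun τ => NatTrans.app τ R) h) n)
    (grPair hn x y)

/-- The degree `n` part of the linear map out of a tensor product given by a bilinear map. -/
def GrMod.tensorDescX {M N P : GrMod l} {φ : ∀ {p q n : ℤ}, p + q = n → M.X p → N.X q → P.X n}
    (hφ : IsGrBilinear (M := M) (N := N) (P := P) φ) (n : ℤ) : GrMod.TensorX M N n →+ P.X n :=
  GrMod.tensorLift (fun p q h x y => φ h x y)
    (fun _ _ h x x' y => hφ.add_left h x x' y) (fun _ _ h x y y' => hφ.add_right h x y y')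
    (fun p q i p' q' h₁ h₂ h₃ h₄ x y a => by
      rw [hφ.act_left rfl h₁ h₂ (by omega), hφ.act_right rfl h₃ h₄ (by omega)])

/-- The linear map out of a tensor product given by a bilinear map. -/
def GrMod.tensorDesc {M N P : GrMod l} {φ : ∀ {p q n : ℤ}, p + q = n → M.X p → N.X q → P.X n}
    (hφ : IsGrBilinear (M := M) (N := N) (P := P) φ) : GrMod.tensor M N ⟶ P where
  toFun n := GrMod.tensorDescX hφ n
  map_act {n i m} h x a := by
    change ((GrMod.tensorDescX hφ m).comp (GrMod.tensorAct M N h a)) x =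
      (((P.act h).flip a).comp (GrMod.tensorDescX hφ n)) x
    revert x
    apply DFunLike.congr_fun
    apply GrMod.tensor_hom_ext
    intro p q hn x y
    rw [AddMonoidHom.comp_apply, AddMonoidHom.comp_apply,
      GrMod.tensorAct_tmul M N h a hn rfl (by omega)]
    exact (FreeAbelianGroup.lift_apply_of _ _).trans ((hφ.act_right hn rfl (by omega) h x y a).trans
      (congrArg (fun z => P.act h z a) (FreeAbelianGroup.lift_apply_of _ _).symm))

theorem GrMod.tensorDesc_tmul {M N P : GrMod l}
    {φ : ∀ {p q n : ℤ}, p + q = n → M.X p → N.X q → P.X n}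
    (hφ : IsGrBilinear (M := M) (N := N) (P := P) φ) {p q n : ℤ} (h : p + q = n) (x : M.X p)
    (y : N.X q) : (GrMod.tensorDesc hφ).toFun n (GrMod.tmul M N h x y) = φ h x y :=
  FreeAbelianGroup.lift_apply_of _ _

theorem IsBilinear.exists_objTensor_hom {H : GrAlg k ⥤ GrMod l}
    {φ : objProd (und F) (und G) ⟶ und H} (hφ : IsBilinear φ) :
    ∃ t : objTensor F G ⟶ H, objTmul F G ≫ undMap t = φ := by
  refine ⟨⟨fun R => GrMod.tensorDesc (hφ R), fun R R' f => ?_⟩, ?_⟩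
  · refine GrMod.Hom.ext (funext fun n => GrMod.tensor_hom_ext fun {p q} hn x y => ?_)
    refine (congrArg ((GrMod.tensorDesc (hφ R')).toFun n)
      (GrMod.tensorMapX_tmul (F.map f) (G.map f) hn x y)).trans ?_
    refine (GrMod.tensorDesc_tmul (hφ R') hn _ _).trans ?_
    refine (app_naturality φ f n (grPair hn x y)).trans ?_
    exact congrArg (fmap H f n) (GrMod.tensorDesc_tmul (hφ R) hn x y).symm
  · exact objProd_hom_ext fun R _ _ _ hn x y => GrMod.tensorDesc_tmul (hφ R) hn x y

/-- Bilinear maps `F × G → H` are the same as natural transformations out of the objectwise tensor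
product, so the two universal properties are equivalent in form. -/
theorem IsUniversalBilinear.representsObjTensor {F G T : FModSch k l}
    {υ : objProd (und F.obj) (und G.obj) ⟶ und T.obj} (h : IsUniversalBilinear υ)
    (hυ : IsBilinear υ) : RepresentsObjTensor υ := by
  obtain ⟨t, rfl⟩ := hυ.exists_objTensor_hom
  refine ⟨t, rfl, fun H => ⟨fun f g hfg => ?_, fun s => ?_⟩⟩
  · have e : t ≫ f.hom = t ≫ g.hom := hfg
    refine (h H (objTmul _ _ ≫ undMap (t ≫ f.hom)) ((isBilinear_objTmul _ _).comp _)).unique rfl ?_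
    rw [e]
    rfl
  · obtain ⟨f, hf, -⟩ := h H (objTmul _ _ ≫ undMap s) ((isBilinear_objTmul _ _).comp s)
    exact ⟨f, objTensor_hom_ext hf⟩

end Bilinear

/-! ### Products and kernel pairs of ind-representable functors. -/

section Smallness

variable {k l : GrCommRing.{u}}

/-- A small union of generating families is small, and can be included up to isomorphism in a
saturated one. -/
theorem exists_isSaturated_isGeneratedBy {A : Type u} {S : A → GrAlg k ⥤ Type u}
    (hS : ∀ a, IsIndObject (unopUnop (GrAlg k) ⋙ S a)) :
    ∃ (ι : Type u) (ob : ι → GrAlg k), IsSaturated ob ∧ ∀ a, IsGeneratedBy ob (S a) := by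
  choose J B hB using fun a => (isLex_and_exists_isGeneratedBy (hS a)).2
  obtain ⟨ι, ob, hob, h⟩ := GrAlg.exists_isSaturated fun z : Σ a, J a => B z.1 z.2
  refine ⟨ι, ob, hob, fun a R s => ?_⟩
  obtain ⟨j, f, x, rfl⟩ := hB a R s
  obtain ⟨i, ⟨φ⟩⟩ := h ⟨a, j⟩
  refine ⟨i, φ.hom ≫ f, (S a).map φ.inv x, ?_⟩
  rw [← types_comp_apply ((S a).map _), ← (S a).map_comp, φ.inv_hom_id_assoc]

/-- A family that generates two formal schemes at the same time. -/
theorem exists_isSaturated_isGeneratedBy₂ {S S' : GrAlg k ⥤ GradedObject ℤ (Type u)}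
    (hS : IsIndRep S) (hS' : IsIndRep S') :
    ∃ (ι : Type u) (ob : ι → GrAlg k), IsSaturated ob ∧
      (∀ n, IsGeneratedBy ob (S ⋙ GradedObject.eval n)) ∧
      ∀ n, IsGeneratedBy ob (S' ⋙ GradedObject.eval n) := by
  obtain ⟨ι, ob, hob, h⟩ := exists_isSaturated_isGeneratedBy
    (A := ULift.{u} (ℤ ⊕ ℤ)) (S := fun a => Sum.elim (fun n => S ⋙ GradedObject.eval n)
      (fun n => S' ⋙ GradedObject.eval n) a.down)
    (by rintro ⟨n | n⟩; exacts [hS n, hS' n])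
  exact ⟨ι, ob, hob, fun n => h ⟨.inl n⟩, fun n => h ⟨.inr n⟩⟩

theorem IsSaturated.exists_common {ι : Type u} {ob : ι → GrAlg k} (hob : IsSaturated ob)
    {S S' : GrAlg k ⥤ Type u} (hS : IsGeneratedBy ob S) (hS' : IsGeneratedBy ob S')
    {R : GrAlg k} (s : S.obj R) (s' : S'.obj R) :
    ∃ (i : ι) (f : ob i ⟶ R) (x : S.obj (ob i)) (x' : S'.obj (ob i)),
      Mono f ∧ S.map f x = s ∧ S'.map f x' = s' := by
  obtain ⟨i, f, x, rfl⟩ := hS R s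
  obtain ⟨j, g, x', rfl⟩ := hS' R s'
  obtain ⟨m, c, f', g', hc, rfl, rfl⟩ := hob.exists_mono f g
  exact ⟨m, c, S.map f' x, S'.map g' x', hc, by simp, by simp⟩

/-- The product of two set-valued functors. -/
@[simps]
def typeProd (S S' : GrAlg k ⥤ Type u) : GrAlg k ⥤ Type u where
  obj R := S.obj R × S'.obj R
  map f := ↾(fun x => (S.map f x.1, S'.map f x.2))

theorem isIndObject_typeProd {S S' : GrAlg k ⥤ Type u} (hS : IsIndObject (unopUnop _ ⋙ S))
    (hS' : IsIndObject (unopUnop _ ⋙ S')) : IsIndObject (unopUnop _ ⋙ typeProd S S') := by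
  obtain ⟨ι, ob, hob, h⟩ := exists_isSaturated_isGeneratedBy
    (A := ULift.{u} Bool) (S := fun a => cond a.down S S') (by rintro ⟨_ | _⟩; exacts [hS', hS])
  have hS := (isLex_and_exists_isGeneratedBy hS).1
  have hS' := (isLex_and_exists_isGeneratedBy hS').1
  refine isIndObject_of_isLex (ob := ob) ⟨fun {R} hR => ?_, fun {A B B' D a a' f f'} sq x x' e => ?_,
    fun {A B B' D a a' f f'} sq z z' e e' => ?_⟩ fun R s => ?_
  · obtain ⟨x, hx⟩ := hS.terminal hR
    obtain ⟨x', hx'⟩ := hS'.terminal hR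
    exact ⟨(x, x'), fun y => Prod.ext (hx y.1) (hx' y.2)⟩
  · obtain ⟨z, hz₁, hz₂⟩ := hS.exists_glue sq x.1 x'.1 (congrArg Prod.fst e)
    obtain ⟨z', hz₁', hz₂'⟩ := hS'.exists_glue sq x.2 x'.2 (congrArg Prod.snd e)
    exact ⟨(z, z'), Prod.ext hz₁ hz₁', Prod.ext hz₂ hz₂'⟩
  · exact Prod.ext (hS.hom_ext sq _ _ (congrArg Prod.fst e) (congrArg Prod.fst e'))
      (hS'.hom_ext sq _ _ (congrArg Prod.snd e) (congrArg Prod.snd e'))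
  · obtain ⟨i, f, x, x', -, hx, hx'⟩ := hob.exists_common (h ⟨true⟩) (h ⟨false⟩) s.1 s.2
    exact ⟨i, f, (x, x'), Prod.ext hx hx'⟩

/-- The kernel pair of a morphism of functors to graded sets. -/
def kernelPair {S T : GrAlg k ⥤ GradedObject ℤ (Type u)} (q : S ⟶ T) :
    GrAlg k ⥤ GradedObject ℤ (Type u) where
  obj R := fun n => {z : S.obj R n × S.obj R n // q.app R n z.1 = q.app R n z.2}
  map {R R'} f := fun n => ↾(fun z => ⟨(S.map f n z.1.1, S.map f n z.1.2), by
    have e : ∀ x, q.app R' n (S.map f n x) = T.map f n (q.app R n x) := fun x =>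
      ConcreteCategory.congr_hom (congrFun (q.naturality f) n) x
    exact (e _).trans ((congrArg (T.map f n) z.2).trans (e _).symm)⟩)
  map_id R := by
    funext n
    refine ConcreteCategory.hom_ext _ _ fun z => Subtype.ext (Prod.ext ?_ ?_)
    · exact ConcreteCategory.congr_hom (congrFun (S.map_id R) n) z.1.1
    · exact ConcreteCategory.congr_hom (congrFun (S.map_id R) n) z.1.2
  map_comp f g := by
    funext n
    refine ConcreteCategory.hom_ext _ _ fun z => Subtype.ext (Prod.ext ?_ ?_)
    · exact ConcreteCategory.congr_hom (congrFun (S.map_comp f g) n) z.1.1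
    · exact ConcreteCategory.congr_hom (congrFun (S.map_comp f g) n) z.1.2

/-- The first projection of a kernel pair. -/
def kernelPairFst {S T : GrAlg k ⥤ GradedObject ℤ (Type u)} (q : S ⟶ T) : kernelPair q ⟶ S where
  app R := fun n => ↾(fun z => z.1.1)

/-- The second projection of a kernel pair. -/
def kernelPairSnd {S T : GrAlg k ⥤ GradedObject ℤ (Type u)} (q : S ⟶ T) : kernelPair q ⟶ S where
  app R := fun n => ↾(fun z => z.1.2)

/-- Pairs glue componentwise, and uniqueness in `T` keeps the result in the kernel pair. For
generation, a pair is lifted to a member that is a subobject of `R`, where `T` is injective, so the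
lifted pair still has equal images. -/
theorem isIndRep_kernelPair {S T : GrAlg k ⥤ GradedObject ℤ (Type u)} (q : S ⟶ T)
    (hS : IsIndRep S) (hT : IsIndRep T) : IsIndRep (kernelPair q) := by
  intro n
  have hq : ∀ {R R' : GrAlg k} (f : R ⟶ R') (x : S.obj R n),
      q.app R' n (S.map f n x) = T.map f n (q.app R n x) := fun f x =>
    ConcreteCategory.congr_hom (congrFun (q.naturality f) n) x
  obtain ⟨ι, ob, hob, h, -⟩ := exists_isSaturated_isGeneratedBy₂ hS hS
  have hS := (isLex_and_exists_isGeneratedBy (hS n)).1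
  have hT := (isLex_and_exists_isGeneratedBy (hT n)).1
  refine isIndObject_of_isLex (ob := ob) ⟨fun {R} hR => ?_, fun {A B B' D a a' f f'} sq x x' e => ?_,
    fun {A B B' D a a' f f'} sq z z' e e' => ?_⟩ fun R s => ?_
  · obtain ⟨x, hx⟩ := hS.terminal hR
    exact ⟨⟨(x, x), rfl⟩, fun y => Subtype.ext (Prod.ext (hx y.1.1) (hx y.1.2))⟩
  · have e := congrArg Subtype.val e
    obtain ⟨z, hz₁, hz₂⟩ := hS.exists_glue sq x.1.1 x'.1.1 (congrArg Prod.fst e)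
    obtain ⟨z', hz₁', hz₂'⟩ := hS.exists_glue sq x.1.2 x'.1.2 (congrArg Prod.snd e)
    refine ⟨⟨(z, z'), hT.hom_ext sq _ _ ?_ ?_⟩, Subtype.ext (Prod.ext hz₁ hz₁'),
      Subtype.ext (Prod.ext hz₂ hz₂')⟩
    · exact (hq a z).symm.trans (((congrArg (q.app B n) hz₁).trans x.2).trans
        ((congrArg (q.app B n) hz₁').symm.trans (hq a z')))
    · exact (hq a' z).symm.trans (((congrArg (q.app B' n) hz₂).trans x'.2).trans
        ((congrArg (q.app B' n) hz₂').symm.trans (hq a' z')))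
  · have e := congrArg Subtype.val e
    have e' := congrArg Subtype.val e'
    exact Subtype.ext (Prod.ext (hS.hom_ext sq _ _ (congrArg Prod.fst e) (congrArg Prod.fst e'))
      (hS.hom_ext sq _ _ (congrArg Prod.snd e) (congrArg Prod.snd e')))
  · obtain ⟨i, f, x, x', _, hx, hx'⟩ := hob.exists_common (h n) (h n) s.1.1 s.1.2
    refine ⟨i, f, ⟨(x, x'), hT.injective f ?_⟩, Subtype.ext (Prod.ext hx hx')⟩
    exact (hq f x).symm.trans (((congrArg (q.app R n) hx).trans s.2).trans
      ((congrArg (q.app R n) hx').symm.trans (hq f x')))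

end Smallness

/-! ### Coproducts of ind-objects and the product of graded formal schemes. -/

section Coproduct

variable {k : GrCommRing.{u}}

/-- Ind-objects have coproducts among ind-objects. -/
theorem exists_indCoproduct {D : Type u} (A : D → GrAlg k ⥤ Type u)
    (hA : ∀ d, IsIndObject (unopUnop (GrAlg k) ⋙ A d)) :
    ∃ (Q : GrAlg k ⥤ Type u) (_ : IsIndObject (unopUnop (GrAlg k) ⋙ Q)) (j : ∀ d, A d ⟶ Q),
      ∀ (Y : GrAlg k ⥤ Type u), IsIndObject (unopUnop (GrAlg k) ⋙ Y) → ∀ φ : ∀ d, A d ⟶ Y,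
        ∃! f : Q ⟶ Y, ∀ d, j d ≫ f = φ d := by
  -- Finite products of algebras are finite coproducts in the opposite category, and these together
  -- with filtered colimits give all small coproducts of ind-objects.
  have : HasFiniteLimits (GrAlg k) := hasFiniteLimits_of_hasTerminal_and_pullbacks
  have : HasFiniteCoproducts (GrAlg k)ᵒᵖ := inferInstance
  have : HasColimitsOfShape (Discrete D) (Ind (GrAlg k)ᵒᵖ) := inferInstance
  have : HasColimitsOfShape (Discrete D)
      (ObjectProperty.FullSubcategory (IsIndObject (C := (GrAlg k)ᵒᵖ))) :=
    Adjunction.hasColimitsOfShape_of_equivalence (Ind.equivalence (GrAlg k)ᵒᵖ).inverse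
  let Z : D → ObjectProperty.FullSubcategory (IsIndObject (C := (GrAlg k)ᵒᵖ)) :=
    fun d => ⟨_, hA d⟩
  -- `opOp ⋙ unopUnop` is definitionally the identity, so whiskering moves between functors on
  -- algebras and presheaves on the opposite category.
  let e : ∀ {S S' : GrAlg k ⥤ Type u}, (unopUnop _ ⋙ S ⟶ unopUnop _ ⋙ S') → (S ⟶ S') :=
    fun τ => Functor.whiskerLeft (opOp (GrAlg k)) τ
  refine ⟨opOp (GrAlg k) ⋙ (∐ Z).obj, (∐ Z).property, fun d => e (S' := opOp _ ⋙ (∐ Z).obj)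
    (Sigma.ι Z d).hom, fun Y hY φ => ?_⟩
  let φ' : ∀ d, Z d ⟶ ⟨_, hY⟩ := fun d =>
    ObjectProperty.homMk (Functor.whiskerLeft (unopUnop (GrAlg k)) (φ d))
  refine ⟨e (S := opOp _ ⋙ (∐ Z).obj) (Limits.Sigma.desc φ').hom, fun d => ?_, fun g hg => ?_⟩
  · have := congrArg (fun m => e m.hom) (Limits.Sigma.ι_desc φ' d)
    exact this
  · have : ObjectProperty.homMk (Functor.whiskerLeft (unopUnop (GrAlg k)) g) = Limits.Sigma.desc φ' := by
      refine Sigma.hom_ext _ _ fun d => ?_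
      rw [Sigma.ι_desc]
      apply ObjectProperty.hom_ext
      exact congrArg (Functor.whiskerLeft (unopUnop (GrAlg k))) (hg d)
    exact congrArg (fun m => e (S := opOp _ ⋙ (∐ Z).obj) m.hom) this

/-- The product of two formal schemes as graded formal schemes. -/
theorem exists_isFormalApprox {S S' : GrAlg k ⥤ GradedObject ℤ (Type u)} (hS : IsIndRep S)
    (hS' : IsIndRep S') : ∃ (P : FSch k) (π : objProd S S' ⟶ P.obj), IsFormalApprox π := by
  -- Degree `n` of `P` is the coproduct of the `S p × S' q`, `p + q = n`, among ind-objects. The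
  -- pointwise coproduct is not left exact: at the zero algebra it has one point for each `(p, q)`.
  let A : ∀ n : ℤ, ULift.{u} {d : ℤ × ℤ // d.1 + d.2 = n} → GrAlg k ⥤ Type u := fun n d =>
    typeProd (S ⋙ GradedObject.eval d.down.1.1) (S' ⋙ GradedObject.eval d.down.1.2)
  choose Q hQ j hj using fun n => exists_indCoproduct (A n) fun d =>
    isIndObject_typeProd (hS d.down.1.1) (hS' d.down.1.2)
  let P : FSch k := ⟨Functor.pi' Q, hQ⟩
  have nat : ∀ {n d} {R R' : GrAlg k} (f : R ⟶ R') (z : (A n d).obj R),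
      (j n d).app R' ((A n d).map f z) = (Q n).map f ((j n d).app R z) := fun f z =>
    ConcreteCategory.congr_hom ((j _ _).naturality f) z
  let π : objProd S S' ⟶ P.obj :=
    { app := fun R => fun n => ↾(fun z => (j n ⟨z.1⟩).app R z.2)
      naturality := fun R R' f => by
        funext n
        exact ConcreteCategory.hom_ext _ _ fun z => nat (d := ⟨z.1⟩) f z.2 }
  refine ⟨P, π, fun Y φ => ?_⟩
  let ψ : ∀ n d, A n d ⟶ Y.obj ⋙ GradedObject.eval n := fun n d =>
    { app := fun R => ↾(fun z => φ.app R n ⟨d.down, z⟩)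
      naturality := fun R R' f => ConcreteCategory.hom_ext _ _ fun z =>
        ConcreteCategory.congr_hom (congrFun (φ.naturality f) n) ⟨d.down, z⟩ }
  choose g hg hg' using fun n => hj n _ (Y.property n) (ψ n)
  refine ⟨ObjectProperty.homMk ⟨fun R => fun n => (g n).app R, fun R R' f =>
    funext fun n => (g n).naturality f⟩, ?_, fun h hh => ?_⟩
  · refine und_hom_ext fun R n z => ?_
    exact ConcreteCategory.congr_hom (congrArg (fun τ => NatTrans.app τ R) (hg n ⟨z.1⟩)) z.2
  · apply ObjectProperty.hom_ext
    refine NatTrans.ext (funext fun R => funext fun n => ?_)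
    have := hg' n (Functor.whiskerRight h.hom (GradedObject.eval n)) fun d => by
      refine NatTrans.ext (funext fun R => ConcreteCategory.hom_ext _ _ fun z => ?_)
      exact ConcreteCategory.congr_hom
        (congrFun (congrArg (fun τ => NatTrans.app τ R) hh) n) ⟨d.down, z⟩
    exact congrArg (fun τ => NatTrans.app τ R) this

end Coproduct

/-! ### Tensor products, free formal module schemes and the coequalizer. -/

section Main

variable {k l : GrCommRing.{u}}

theorem isGeneratedBy_objProd {ι : Type u} {ob : ι → GrAlg k} (hob : IsSaturated ob)
    {S S' : GrAlg k ⥤ GradedObject ℤ (Type u)}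
    (hS : ∀ n, IsGeneratedBy ob (S ⋙ GradedObject.eval n))
    (hS' : ∀ n, IsGeneratedBy ob (S' ⋙ GradedObject.eval n)) (n : ℤ) :
    IsGeneratedBy ob (objProd S S' ⋙ GradedObject.eval n) := by
  rintro R ⟨⟨⟨p, q⟩, h⟩, x, y⟩
  obtain ⟨i, f, x', y', -, hx, hy⟩ := hob.exists_common (hS p) (hS' q) x y
  exact ⟨i, f, grPair h x' y', congrArg₂ (grPair h) hx hy⟩

theorem exists_isUniversalBilinear (F G : FModSch k l) :
    ∃ (T : FModSch k l) (υ : objProd (und F.obj) (und G.obj) ⟶ und T.obj),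
      IsBilinear υ ∧ IsUniversalBilinear υ := by
  obtain ⟨ι, ob, hob, hF, hG⟩ := exists_isSaturated_isGeneratedBy₂ F.property G.property
  exact exists_universal hob (isGeneratedBy_objProd hob hF hG)
    (Φ := fun _ φ => IsBilinear φ) fun σ φ => IsBilinear.of_injective σ φ

theorem exists_free (X : FSch k) :
    ∃ (T : FModSch k l) (η : X ⟶ (FModSch.forget k l).obj T),
      ∀ (H : FModSch k l) (φ : X ⟶ (FModSch.forget k l).obj H),
        ∃! f : T ⟶ H, η ≫ (FModSch.forget k l).map f = φ := by
  obtain ⟨ι, ob, hob, hX, -⟩ := exists_isSaturated_isGeneratedBy₂ X.property X.property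
  obtain ⟨T, υ, -, hυ⟩ := exists_universal (l := l) hob hX (Φ := fun _ _ => True)
    fun _ _ _ _ => trivial
  refine ⟨T, ObjectProperty.homMk υ, fun H φ => ?_⟩
  obtain ⟨f, hf, hf'⟩ := hυ H φ.hom trivial
  exact ⟨f, ObjectProperty.hom_ext _ hf, fun g hg =>
    hf' g (congrArg (fun m => m.hom) hg)⟩

theorem exists_free_adjunction (k l : GrCommRing.{u}) :
    ∃ Fr : FSch k ⥤ FModSch k l, Nonempty (Fr ⊣ FModSch.forget k l) := by
  choose T η hη using exists_free (k := k) (l := l)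
  let e : ∀ (X : FSch k) (H : FModSch k l), (T X ⟶ H) ≃ (X ⟶ (FModSch.forget k l).obj H) :=
    fun X H => Equiv.ofBijective (fun f => η X ≫ (FModSch.forget k l).map f)
      ⟨fun f g h => (hη X H _).unique h rfl, fun φ => (hη X H φ).exists⟩
  have he : ∀ (X : FSch k) (H H' : FModSch k l) (g : H ⟶ H') (f : T X ⟶ H),
      e X H' (f ≫ g) = e X H f ≫ (FModSch.forget k l).map g := fun X H H' g f =>
    (Category.assoc (η X) ((FModSch.forget k l).map f) ((FModSch.forget k l).map g)).symm
  exact ⟨_, ⟨Adjunction.adjunctionOfEquivLeft e he⟩⟩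

/-- If `q` identifies fewer elements than `s` and makes `η` bilinear, then so does `s`. -/
theorem IsBilinear.of_comp {F G A T H : GrAlg k ⥤ GrMod l}
    (η : objProd (und F) (und G) ⟶ und A) (q : A ⟶ T) (s : A ⟶ H)
    (hη : IsBilinear (η ≫ undMap q))
    (hqs : ∀ {R : GrAlg k} {n : ℤ} (u v : (A.obj R).X n),
      (q.app R).toFun n u = (q.app R).toFun n v → (s.app R).toFun n u = (s.app R).toFun n v) :
    IsBilinear (η ≫ undMap s) := by
  intro R
  let b : ∀ {p q n : ℤ}, p + q = n → (F.obj R).X p → (G.obj R).X q → (A.obj R).X n :=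
    fun {_ _ n} h x y => η.app R n (grPair h x y)
  refine
    { add_left := fun h x x' y => ?_, add_right := fun h x y y' => ?_,
      act_right := fun h h₁ h₂ h₃ x y c => ?_,
      act_left := fun {p r i n p' m} h h₁ h₂ h₃ x y c => ?_ }
  · exact (hqs (b h (x + x') y) (b h x y + b h x' y)
      (((hη R).add_left h x x' y).trans
        (map_add ((q.app R).toFun _) (b h x y) (b h x' y)).symm)).trans (map_add _ _ _)
  · exact (hqs (b h x (y + y')) (b h x y + b h x y')
      (((hη R).add_right h x y y').trans
        (map_add ((q.app R).toFun _) (b h x y) (b h x y')).symm)).trans (map_add _ _ _)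
  · exact (hqs (b h₂ x ((G.obj R).act h₁ y c)) ((A.obj R).act h₃ (b h x y) c)
      (((hη R).act_right h h₁ h₂ h₃ x y c).trans ((q.app R).map_act h₃ _ c).symm)).trans
      ((s.app R).map_act h₃ _ c)
  · have smul : ∀ {K : GrAlg k ⥤ GrMod l} (τ : A ⟶ K), (τ.app R).toFun m ((i * r).negOnePow •
        (A.obj R).act h₃ (b h x y) c) = (i * r).negOnePow •
          (K.obj R).act h₃ ((τ.app R).toFun n (b h x y)) c := fun τ => by
      rw [Units.smul_def, Units.smul_def, map_zsmul, (τ.app R).map_act]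
    exact (hqs (b h₂ ((F.obj R).act h₁ x c) y) _
      (((hη R).act_left h h₁ h₂ h₃ x y c).trans (smul q).symm)).trans (smul s)

/-- If `T` is universal for bilinear maps on `F × G`, then the free module on the product of `F` and
`G` coequalizes to `T`. -/
theorem exists_coequalizer {Fr : FSch k ⥤ FModSch k l} (adj : Fr ⊣ FModSch.forget k l)
    {F G T : FModSch k l} {υ : objProd (und F.obj) (und G.obj) ⟶ und T.obj}
    (hυ : IsBilinear υ) (hT : IsUniversalBilinear υ) :
    ∃ (P : FSch k) (π : objProd (und F.obj) (und G.obj) ⟶ P.obj),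
      IsFormalApprox π ∧
      ∃ (X : FSch k) (f g : Fr.obj X ⟶ Fr.obj P) (q : Fr.obj P ⟶ T) (w : f ≫ q = g ≫ q),
        Nonempty (IsColimit (Cofork.ofπ q w)) ∧ π ≫ (adj.homEquiv P T q).hom = υ := by
  let V := FModSch.forget k l
  obtain ⟨P, π, hπ⟩ := exists_isFormalApprox F.property G.property
  obtain ⟨υ', hυ', -⟩ := hπ (V.obj T) υ
  let q : Fr.obj P ⟶ T := (adj.homEquiv P T).symm υ'
  have hq : adj.homEquiv P T q = υ' := (adj.homEquiv P T).apply_symm_apply υ'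
  let X : FSch k := ⟨kernelPair (V.map q).hom,
    isIndRep_kernelPair _ (Fr.obj P).property T.property⟩
  let a : X ⟶ V.obj (Fr.obj P) := ObjectProperty.homMk (kernelPairFst (V.map q).hom)
  let b : X ⟶ V.obj (Fr.obj P) := ObjectProperty.homMk (kernelPairSnd (V.map q).hom)
  let f : Fr.obj X ⟶ Fr.obj P := (adj.homEquiv X _).symm a
  let g : Fr.obj X ⟶ Fr.obj P := (adj.homEquiv X _).symm b
  have hf : ∀ {H : FModSch k l} (s : Fr.obj P ⟶ H), adj.homEquiv X H (f ≫ s) = a ≫ V.map s :=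
    fun s => by rw [adj.homEquiv_naturality_right, Equiv.apply_symm_apply]
  have hg : ∀ {H : FModSch k l} (s : Fr.obj P ⟶ H), adj.homEquiv X H (g ≫ s) = b ≫ V.map s :=
    fun s => by rw [adj.homEquiv_naturality_right, Equiv.apply_symm_apply]
  have w : f ≫ q = g ≫ q := by
    apply (adj.homEquiv X T).injective
    rw [hf, hg]
    apply ObjectProperty.hom_ext
    exact und_hom_ext fun R n z => z.2
  -- Maps out of `Fr P` are determined by their restriction along `η`, by the adjunction and the
  -- universal property of `π`; `q` is the map that restricts to `υ`.
  let η : objProd (und F.obj) (und G.obj) ⟶ und (Fr.obj P).obj := π ≫ (adj.unit.app P).hom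
  have hη : ∀ {H : FModSch k l} (s : Fr.obj P ⟶ H),
      η ≫ undMap s.hom = π ≫ (adj.homEquiv P H s).hom := fun s => by
    rw [adj.homEquiv_unit]
    rfl
  have hηq : η ≫ undMap q.hom = υ := by rw [hη, hq, hυ']
  have ext : ∀ {H : FModSch k l} {s t : Fr.obj P ⟶ H},
      η ≫ undMap s.hom = η ≫ undMap t.hom → s = t := fun {H s t} h => by
    rw [hη, hη] at h
    exact (adj.homEquiv P H).injective ((hπ _ _).unique h rfl)
  have bilin : ∀ {H : FModSch k l} (s : Fr.obj P ⟶ H), f ≫ s = g ≫ s →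
      IsBilinear (η ≫ undMap s.hom) := by
    intro H s hs
    have e : a ≫ V.map s = b ≫ V.map s := by rw [← hf, ← hg, hs]
    have e' : (a ≫ V.map s).hom = (b ≫ V.map s).hom := by rw [e]
    -- Two elements identified by `q` form an element of the kernel pair, on which `s` takes equal
    -- values.
    have key : ∀ {R : GrAlg k} {n : ℤ} (u v : ((Fr.obj P).obj.obj R).X n),
        (q.hom.app R).toFun n u = (q.hom.app R).toFun n v →
          (s.hom.app R).toFun n u = (s.hom.app R).toFun n v := fun {R n} u v huv =>
      ConcreteCategory.congr_hom (congrFun (congrArg (fun τ => NatTrans.app τ R) e') n) ⟨(u, v), huv⟩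
    exact IsBilinear.of_comp η q.hom s.hom (hηq.symm ▸ hυ) key
  have desc : ∀ {H : FModSch k l} (s : Fr.obj P ⟶ H), f ≫ s = g ≫ s →
      ∃ m : T ⟶ H, q ≫ m = s := by
    intro H s hs
    obtain ⟨m, hm, -⟩ := hT H _ (bilin s hs)
    refine ⟨m, ext (Eq.trans ?_ hm)⟩
    rw [← hηq]
    rfl
  have mono : ∀ {H : FModSch k l} {m m' : T ⟶ H}, q ≫ m = q ≫ m' → m = m' := by
    intro H m m' h
    refine (hT H (υ ≫ undMap m'.hom) (hυ.comp _)).unique ?_ rfl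
    rw [← hηq]
    exact congrArg (fun s : Fr.obj P ⟶ H => η ≫ undMap s.hom) h
  choose d hd using fun s : Cofork f g => desc s.π s.condition
  refine ⟨P, π, hπ, X, f, g, q, w, ⟨Cofork.IsColimit.mk _ d hd fun s m hm =>
    mono (hm.trans (hd s).symm)⟩, ?_⟩
  rw [hq, hυ']

theorem mainTheorem6 (k l : GrCommRing.{u}) :
    ∃ (T : FModSch k l × FModSch k l ⥤ FModSch k l)
      (υ : ∀ F G : FModSch k l, objProd (und F.obj) (und G.obj) ⟶ und (T.obj (F, G)).obj),
      (∀ F G, IsBilinear (υ F G)) ∧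
      (∀ (F F' G G' : FModSch k l) (σ : F ⟶ F') (τ : G ⟶ G'),
        υ F G ≫ undMap (T.map (Prod.mkHom σ τ)).hom =
          objProdMap (undMap σ.hom) (undMap τ.hom) ≫ υ F' G') ∧
      (∀ F G, RepresentsObjTensor (υ F G)) ∧
      (∀ F G, IsUniversalBilinear (υ F G)) ∧
      ∃ (Fr : FSch k ⥤ FModSch k l) (adj : Fr ⊣ FModSch.forget k l),
        ∀ F G : FModSch k l,
          ∃ (P : FSch k) (π : objProd (und F.obj) (und G.obj) ⟶ P.obj),
            IsFormalApprox π ∧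
            ∃ (X : FSch k) (f g : Fr.obj X ⟶ Fr.obj P) (q : Fr.obj P ⟶ T.obj (F, G))
              (w : f ≫ q = g ≫ q),
              Nonempty (IsColimit (Cofork.ofπ q w)) ∧
              π ≫ (adj.homEquiv P (T.obj (F, G)) q).hom = υ F G := by
  choose T υ hυ hT using exists_isUniversalBilinear (k := k) (l := l)
  -- The map `σ ⊗ τ` is the factorization of the bilinear map `υ ∘ (σ × τ)`; functoriality follows
  -- from uniqueness.
  choose m hm using fun (z z' : FModSch k l × FModSch k l) (σ : z ⟶ z') =>
    (hT z.1 z.2 (T z'.1 z'.2) _ ((hυ z'.1 z'.2).precomp σ.1.hom σ.2.hom)).exists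
  have ext : ∀ {F G H : FModSch k l} {f f' : T F G ⟶ H},
      υ F G ≫ undMap f.hom = υ F G ≫ undMap f'.hom → f = f' := fun {F G H f f'} h =>
    (hT F G H (υ F G ≫ undMap f'.hom) ((hυ F G).comp _)).unique h rfl
  let TF : FModSch k l × FModSch k l ⥤ FModSch k l :=
    { obj := fun z => T z.1 z.2
      map := fun {z z'} σ => m z z' σ
      map_id := fun z => ext ((hm z z (𝟙 z)).trans rfl)
      map_comp := fun {z z' z''} σ τ => ext (by
        refine (hm z z'' (σ ≫ τ)).trans ?_
        refine Eq.trans ?_ (congrArg (fun ψ => ψ ≫ undMap (m z' z'' τ).hom) (hm z z' σ)).symm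
        refine Eq.trans ?_ (congrArg (fun ψ =>
          objProdMap (undMap σ.1.hom) (undMap σ.2.hom) ≫ ψ) (hm z' z'' τ)).symm
        rfl) }
  obtain ⟨Fr, ⟨adj⟩⟩ := exists_free_adjunction k l
  exact ⟨TF, υ, hυ, fun F F' G G' σ τ => hm (F, G) (F', G') (Prod.mkHom σ τ),
    fun F G => (hT F G).representsObjTensor (hυ F G), hT, Fr, adj,
    fun F G => exists_coequalizer adj (hυ F G) (hT F G)⟩

end Main
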